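/- Theorem 2.1. For a function $f$ on $\mathbb{R}^n$ write $\hat f(\xi)=\int_{\mathbb{R}^n} f(x)e^{-ix\cdot\xi}\,dx$ (extended to $L^2(\mathbb{R}^n)$ as usual). For $s>0$ let $H^s(\mathbb{R}^n)$ be the Sobolev space of all $f\in L^2(\mathbb{R}^n)$ with $$\|f\|_{H^s(\mathbb{R}^n)}^2=(2\pi)^{-n}\int_{\mathbb{R}^n}(1+|\xi|^2)^s|\hat f(\xi)|^2\,d\xi<\infty .$$ For $t\in\mathbb{R}$ and $f\in L^2(\mathbb{R}^n)$ let $e^{it\Delta}f\in L^2(\mathbb{R}^n)$ be the function with Fourier transform $e^{it|\xi|^2}\hat f(\xi)$, so that $(e^{it\Delta}f)(x)=(2\pi)^{-n}\int_{\mathbb{R}^n}\hat f(\xi)e^{i(\xi\cdot x+|\xi|^2t)}\,d\xi$ for Schwartz functions $f$. Let $B_n(0,1)$ be the Euclidean unit ball of $\mathbb{R}^n$. As $e^{it\Delta}f$ is defined only up to null sets, which depend on $t$, the supremum $\sup_{0<t<1}|e^{it\Delta}f|$ is understood in the almost-everywhere sense (the least measurable function that, for each $t\in(0,1)$, is at least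 $|e^{it\Delta}f|$ almost everywhere); if $e^{it\Delta}f(x)$ has a version that for a.e. $x$ is continuous in $t\in(0,1)$, for instance if $f$ is a Schwartz function, it is a.e. the pointwise supremum of that version. Let $n\ge 2$ and $s>0$, and suppose that there is a constant $C_s$ such that for all $f\in H^s(\mathbb{R}^n)$, $$\Big\|\sup_{0<t<1}|e^{it\Delta}f|\,\Big\|_{L^1(B_n(0,1))}\le C_s\|f\|_{H^s(\mathbb{R}^n)} .$$ Then $s\ge \dfrac{n}{2(n+1)}$. -/

import Mathlib

open MeasureTheory
open scoped ENNReal NNReal FourierTransform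

noncomputable section

/-- The multiplier of `e^{itΔ}`. In the frequency variable `η` of Mathlib's Fourier transform
`𝓕 f η = ∫ e^{-2π i ⟨x, η⟩} f x dx` (so that `ξ = 2π η` is the frequency of the transform
`∫ e^{-i ⟨x, ξ⟩} f x dx`), the factor `e^{i t |ξ|²}` reads `e^{4 π² i t |η|²}`. -/
def schrodingerSymbol (n : ℕ) (t : ℝ) (η : EuclideanSpace ℝ (Fin n)) : ℂ :=
  Complex.exp (((t * (2 * Real.pi * ‖η‖) ^ 2 : ℝ) : ℂ) * Complex.I)

theorem memLp_schrodingerSymbol_mul {n : ℕ} (t : ℝ)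
    (g : Lp ℂ 2 (volume : Measure (EuclideanSpace ℝ (Fin n)))) :
    MemLp (fun η => schrodingerSymbol n t η * g η) 2 volume := by
  have hc : Continuous (schrodingerSymbol n t) := by
    unfold schrodingerSymbol
    fun_prop
  refine (Lp.memLp g).of_le (hc.aestronglyMeasurable.mul (Lp.aestronglyMeasurable g)) ?_
  refine Filter.Eventually.of_forall fun η => ?_
  rw [norm_mul, schrodingerSymbol, Complex.norm_exp_ofReal_mul_I, one_mul]

/-- The Schrödinger evolution `e^{itΔ} f` of `f ∈ L²(ℝⁿ)`, for a fixed time `t`, as an element of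
`L²(ℝⁿ)`: the function with Fourier transform `e^{i t |ξ|²} f̂(ξ)`. -/
def schrodingerEvolution {n : ℕ} (t : ℝ)
    (f : Lp ℂ 2 (volume : Measure (EuclideanSpace ℝ (Fin n)))) :
    Lp ℂ 2 (volume : Measure (EuclideanSpace ℝ (Fin n))) :=
  𝓕⁻ ((memLp_schrodingerSymbol_mul t (𝓕 f)).toLp)

/-- The Sobolev norm `‖f‖_{H^s} = ((2π)^{-n} ∫ (1 + |ξ|²)^s |f̂(ξ)|² dξ)^{1/2}`, with values in
`[0, ∞]`, written in the frequency variable `η = ξ / (2π)`; the Jacobian of this change of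
variables cancels the factor `(2π)^{-n}`. -/
def sobolevNorm {n : ℕ} (s : ℝ) (f : Lp ℂ 2 (volume : Measure (EuclideanSpace ℝ (Fin n)))) :
    ℝ≥0∞ :=
  (∫⁻ η : EuclideanSpace ℝ (Fin n),
    ENNReal.ofReal ((1 + (2 * Real.pi * ‖η‖) ^ 2) ^ s) * ‖(𝓕 f) η‖ₑ ^ 2) ^ (1 / 2 : ℝ)

/-- `u` chooses, for every `0 < t < 1`, a function `u t` in the class `e^{itΔ} f`. -/
def IsSchrodingerVersion {n : ℕ} (f : Lp ℂ 2 (volume : Measure (EuclideanSpace ℝ (Fin n))))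
    (u : ℝ → EuclideanSpace ℝ (Fin n) → ℂ) : Prop :=
  ∀ t ∈ Set.Ioo (0 : ℝ) 1, u t =ᵐ[volume] schrodingerEvolution t f

/-- The norm `‖ sup_{0 < t < 1} |e^{itΔ} f| ‖_{L¹(B(0,1))}`, with values in `[0, ∞]`.

For `f ∈ L²` each `e^{itΔ} f` is only defined almost everywhere, so a supremum over uncountably many
`t` depends on the choice of representatives. It is taken in the usual almost-everywhere sense, as
the smallest value over all choices. If `e^{itΔ} f` has a version that is continuous in `t`
(as for every Schwartz function `f`), then this is the `L¹` norm of the pointwise supremum of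
that version: see `schrodingerMaximalNorm_eq_of_continuousOn`. -/
def schrodingerMaximalNorm {n : ℕ}
    (f : Lp ℂ 2 (volume : Measure (EuclideanSpace ℝ (Fin n)))) : ℝ≥0∞ :=
  ⨅ (u : ℝ → EuclideanSpace ℝ (Fin n) → ℂ) (_ : IsSchrodingerVersion f u),
    ∫⁻ x in Metric.ball (0 : EuclideanSpace ℝ (Fin n)) 1, ⨆ t ∈ Set.Ioo (0 : ℝ) 1, ‖u t x‖ₑ

theorem schrodingerMaximalNorm_eq_of_continuousOn {n : ℕ}
    (f : Lp ℂ 2 (volume : Measure (EuclideanSpace ℝ (Fin n))))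
    (u : ℝ → EuclideanSpace ℝ (Fin n) → ℂ) (hu : IsSchrodingerVersion f u)
    (hc : ∀ᵐ x, ContinuousOn (fun t => u t x) (Set.Ioo (0 : ℝ) 1)) :
    schrodingerMaximalNorm f =
      ∫⁻ x in Metric.ball (0 : EuclideanSpace ℝ (Fin n)) 1,
        ⨆ t ∈ Set.Ioo (0 : ℝ) 1, ‖u t x‖ₑ := by
  refine le_antisymm (iInf₂_le u hu) (le_iInf₂ fun v hv => ?_)
  have hq : ∀ᵐ x, ∀ q : ℚ, (q : ℝ) ∈ Set.Ioo (0 : ℝ) 1 → u q x = v q x := by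
    rw [ae_all_iff]
    intro q
    by_cases h : (q : ℝ) ∈ Set.Ioo (0 : ℝ) 1
    · filter_upwards [hu q h, hv q h] with x h1 h2 _
      rw [h1, h2]
    · exact Filter.Eventually.of_forall fun x hx => absurd hx h
  refine lintegral_mono_ae (ae_restrict_of_ae ?_)
  filter_upwards [hq, hc] with x hx hcx
  refine iSup₂_le fun t ht => ?_
  by_contra! hlt
  have hopen : IsOpen (Set.Ioo (0 : ℝ) 1 ∩
      (fun r => ‖u r x‖ₑ) ⁻¹' Set.Ioi (⨆ r ∈ Set.Ioo (0 : ℝ) 1, ‖v r x‖ₑ)) :=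
    (continuous_enorm.comp_continuousOn hcx).isOpen_inter_preimage isOpen_Ioo isOpen_Ioi
  obtain ⟨r, ⟨hr, hr'⟩, q, rfl⟩ :=
    (Rat.denseRange_cast (𝕜 := ℝ)).inter_open_nonempty _ hopen ⟨t, ht, hlt⟩
  have hle : ‖v q x‖ₑ ≤ ⨆ r ∈ Set.Ioo (0 : ℝ) 1, ‖v r x‖ₑ :=
    le_iSup₂ (f := fun (r : ℝ) (_ : r ∈ Set.Ioo (0 : ℝ) 1) => ‖v r x‖ₑ) (q : ℝ) hr
  rw [← hx q hr] at hle
  exact absurd hr' (not_lt.mpr hle)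

end

/-! The counterexample is of Bourgain's type. Put `n = d + 1`, let `m` be a large integer, `R =
m^(2d+4)`, `D = m^(d+3)`, `L = m^(d+1)`, so `D L = R`. The Fourier transform of `f` is the indicator
of a product set: an interval of length about `R^(1/2)` at `-R` in the first coordinate, and `L`
short intervals at the multiples of `D` in each of the other `d`. The evolution factors into
one-dimensional integrals of `e(x u + τ u²)`, where `τ = 2π t`.

Take `τ = a / (2 q D²)` with `a` coprime to `q` and `a q` even. The first factor has no cancellation
when the first coordinate is within `R^(-1/2)` of `2 R τ = a / (m² q)`. If `D x_j` is within about
`1 / L` of `b_j / q`, the `j`-th remaining factor is essentially a Gauss sum of length `L`, of size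
`L / √q` (`le_norm_integral_lattice`).

Such points fill the ball up to a logarithm. Dirichlet's theorem with `P = 32 m` gives all `x_j` a
common denominator `q ≤ P^d`, and for half of a cube `q` must be comparable to `P^d`
(`exists_measurableSet_approximable`), which makes the approximation as good as `1 / L`. For this
`q`, the neighbourhoods of the admissible `a / (m² q)` have measure at least a constant over `log
m`, by a lower bound for Euler's totient (`exists_measurableSet_close_fraction`). So the supremum is
at least `A`, about `m^(d+2) (m^(d+1) / m^(d/2))^d`, on a set of measure about `1 / log m`.

The squared `L²` norm `V` of `f` is about `m^(d+2) m^(d(d+1))`, and `A² / V` is about `m^(2d+2)`.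
The frequencies are `O(R)`, so the estimate forces `m^(d+1) ≲ (log m) R^s`, hence `s ≥ (d+1) /
(2d+4) = n / (2(n+1))`. -/

/-! ### The `L²` Fourier transform on `L¹ ∩ L²`, and membership in Sobolev spaces. -/

section FourierBridge

variable {V : Type*} [NormedAddCommGroup V] [InnerProductSpace ℝ V] [FiniteDimensional ℝ V]
  [MeasurableSpace V] [BorelSpace V]

/-- The multiplication formula for the inverse Fourier transform. -/
theorem integral_fourierInv_mul_eq {f g : V → ℂ} (hf : Integrable f) (hg : Integrable g) :
    ∫ ξ, 𝓕⁻ f ξ * g ξ = ∫ x, f x * 𝓕⁻ g x := by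
  have hL : Continuous fun p : V × V => (-innerₗ V p.1) p.2 := by
    simp only [LinearMap.neg_apply, innerₗ_apply_apply]
    fun_prop
  have h := VectorFourier.integral_fourierIntegral_smul_eq_flip (L := -innerₗ V)
    (μ := (volume : Measure V)) (ν := (volume : Measure V))
    Real.continuous_fourierChar hL hf hg
  simp only [smul_eq_mul] at h
  convert! h using 3 with ξ x
  rw [Real.fourierInv_eq]
  simp [VectorFourier.fourierIntegral, real_inner_comm]

theorem continuous_fourierInv {f : V → ℂ} (hf : Integrable f) : Continuous (𝓕⁻ f) := by
  have hL : Continuous fun p : V × V => (innerₗ V p.1) p.2 := by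
    simp only [innerₗ_apply_apply]
    fun_prop
  rw [Real.fourierInv_eq_fourier_comp_neg]
  exact VectorFourier.fourierIntegral_continuous (L := innerₗ V) (μ := (volume : Measure V))
    Real.continuous_fourierChar hL hf.comp_neg

/-- On `L¹ ∩ L²`, the `L²` inverse Fourier transform is given by the integral. -/
theorem fourierInv_toLp_ae_eq {h : V → ℂ} (h1 : Integrable h) (h2 : MemLp h 2 volume) :
    ((𝓕⁻ h2.toLp : Lp ℂ 2 (volume : Measure V)) : V → ℂ) =ᵐ[volume] 𝓕⁻ h := by
  -- Both sides are tested against smooth compactly supported functions. These are Schwartz, so the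
  -- distributional definition and the multiplication formula each move the inverse transform onto
  -- the test function.
  refine ae_eq_of_integral_contDiff_smul_eq ((Lp.memLp _).locallyIntegrable (by norm_num))
    (continuous_fourierInv h1).locallyIntegrable fun g hg hgc => ?_
  have hgC : ContDiff ℝ (⊤ : ℕ∞) (fun x => (g x : ℂ)) := Complex.ofRealCLM.contDiff.comp hg
  have hgcC : HasCompactSupport (fun x => (g x : ℂ)) := hgc.comp_left Complex.ofReal_zero
  let φ : SchwartzMap V ℂ := hgcC.toSchwartzMap hgC
  have hφ : ∀ x, φ x = (g x : ℂ) := fun x => rfl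
  have e := congrArg (fun T : TemperedDistribution V ℂ => T φ)
    (Lp.fourierInv_toTemperedDistribution_eq (h2.toLp))
  simp only [TemperedDistribution.fourierInv_apply, Lp.toTemperedDistribution_apply,
    smul_eq_mul, hφ] at e
  simp only [Complex.real_smul]
  rw [← e]
  have e2 := integral_fourierInv_mul_eq (φ.integrable (μ := volume)) h1
  rw [SchwartzMap.fourierInv_coe]
  simp only [hφ] at e2
  rw [← e2]
  refine integral_congr_ae ?_
  filter_upwards [h2.coeFn_toLp] with x hx
  rw [hx]

/-- A function with bounded Fourier support belongs to every Sobolev space `H^s`. -/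
theorem memSobolev_fourierInv_toLp (s : ℝ) {h : V → ℂ} (h2 : MemLp h 2 volume) {ρ : ℝ}
    (hρ : ∀ η, h η ≠ 0 → ‖η‖ ≤ ρ) :
    TemperedDistribution.MemSobolev s 2
      ((𝓕⁻ h2.toLp : Lp ℂ 2 (volume : Measure V)) : TemperedDistribution V ℂ) := by
  rw [TemperedDistribution.memSobolev_iff_exists_smulLeftCLM_fourier,
    Lp.fourier_toTemperedDistribution_eq, FourierTransform.fourier_fourierInv_eq]
  have hwc : Continuous fun x : V => (((1 + ‖x‖ ^ 2) ^ (s / 2) : ℝ) : ℂ) := by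
    refine Complex.continuous_ofReal.comp (Continuous.rpow_const (by fun_prop) fun x => ?_)
    left; positivity
  obtain ⟨B, hB⟩ : ∃ B : ℝ, ∀ x ∈ Metric.closedBall (0 : V) ρ,
      ‖(((1 + ‖x‖ ^ 2) ^ (s / 2) : ℝ) : ℂ)‖ ≤ B :=
    (isCompact_closedBall 0 ρ).exists_bound_of_continuousOn hwc.continuousOn
  have hm : MemLp (fun x : V => (((1 + ‖x‖ ^ 2) ^ (s / 2) : ℝ) : ℂ) * h x) 2 volume := by
    refine MemLp.of_le_mul (c := B) h2 (hwc.aestronglyMeasurable.mul h2.1) ?_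
    refine Filter.Eventually.of_forall fun x => ?_
    by_cases hx : h x = 0
    · simp [hx]
    · rw [norm_mul]
      exact mul_le_mul_of_nonneg_right (hB x (by simpa using hρ x hx)) (norm_nonneg _)
  refine ⟨hm.toLp, ?_⟩
  ext φ
  rw [TemperedDistribution.smulLeftCLM_apply_apply, Lp.toTemperedDistribution_apply,
    Lp.toTemperedDistribution_apply]
  refine integral_congr_ae ?_
  filter_upwards [h2.coeFn_toLp, hm.coeFn_toLp] with x hx hx'
  rw [hx, hx', SchwartzMap.smulLeftCLM_apply_apply (by fun_prop)]
  simp only [smul_eq_mul]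
  ring

end FourierBridge

/-! ### The evolution and its maximal function for data given on the Fourier side. -/

section Evolution

variable {n : ℕ}

theorem continuous_schrodingerSymbol (t : ℝ) : Continuous (schrodingerSymbol n t) := by
  unfold schrodingerSymbol
  fun_prop

theorem norm_schrodingerSymbol (t : ℝ) (η : EuclideanSpace ℝ (Fin n)) :
    ‖schrodingerSymbol n t η‖ = 1 := by
  rw [schrodingerSymbol, Complex.norm_exp_ofReal_mul_I]

theorem integrable_schrodingerSymbol_mul (t : ℝ) {h : EuclideanSpace ℝ (Fin n) → ℂ}
    (h1 : Integrable h) : Integrable fun η => schrodingerSymbol n t η * h η :=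
  h1.bdd_mul (c := 1) (continuous_schrodingerSymbol t).aestronglyMeasurable
    (Filter.Eventually.of_forall fun η => (norm_schrodingerSymbol t η).le)

theorem schrodingerEvolution_fourierInv_ae_eq (t : ℝ) {h : EuclideanSpace ℝ (Fin n) → ℂ}
    (h1 : Integrable h) (h2 : MemLp h 2 volume) :
    (schrodingerEvolution t (𝓕⁻ h2.toLp) : EuclideanSpace ℝ (Fin n) → ℂ) =ᵐ[volume]
      𝓕⁻ fun η => schrodingerSymbol n t η * h η := by
  have hm : MemLp (fun η => schrodingerSymbol n t η * h η) 2 volume := by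
    refine h2.of_le ((continuous_schrodingerSymbol t).aestronglyMeasurable.mul h2.1) ?_
    exact Filter.Eventually.of_forall fun η => by
      rw [norm_mul, norm_schrodingerSymbol, one_mul]
  have e : schrodingerEvolution t (𝓕⁻ h2.toLp) = 𝓕⁻ hm.toLp := by
    unfold schrodingerEvolution
    congr 1
    refine MemLp.toLp_congr _ _ ?_
    rw [FourierTransform.fourier_fourierInv_eq]
    filter_upwards [h2.coeFn_toLp] with x hx
    rw [hx]
  rw [e]
  exact fourierInv_toLp_ae_eq (integrable_schrodingerSymbol_mul t h1) hm

/-- For Fourier transforms in `L¹ ∩ L²` the maximal function is the pointwise supremum of the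
integrals defining the evolution. -/
theorem schrodingerMaximalNorm_fourierInv {h : EuclideanSpace ℝ (Fin n) → ℂ}
    (h1 : Integrable h) (h2 : MemLp h 2 volume) :
    schrodingerMaximalNorm (𝓕⁻ h2.toLp) =
      ∫⁻ x in Metric.ball (0 : EuclideanSpace ℝ (Fin n)) 1,
        ⨆ t ∈ Set.Ioo (0 : ℝ) 1, ‖𝓕⁻ (fun η => schrodingerSymbol n t η * h η) x‖ₑ := by
  refine schrodingerMaximalNorm_eq_of_continuousOn _
    (fun t => 𝓕⁻ fun η => schrodingerSymbol n t η * h η)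
    (fun t _ => (schrodingerEvolution_fourierInv_ae_eq t h1 h2).symm) ?_
  refine Filter.Eventually.of_forall fun x => Continuous.continuousOn ?_
  simp only [Real.fourierInv_eq']
  refine continuous_of_dominated (bound := fun η => ‖h η‖) (fun t => ?_) (fun t => ?_)
    h1.norm ?_
  · have hc : Continuous fun η : EuclideanSpace ℝ (Fin n) =>
        Complex.exp (((2 * Real.pi * inner ℝ η x : ℝ) : ℂ) * Complex.I) := by fun_prop
    exact hc.aestronglyMeasurable.smul (integrable_schrodingerSymbol_mul t h1).1
  · refine Filter.Eventually.of_forall fun η => ?_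
    rw [norm_smul, norm_mul, norm_schrodingerSymbol, Complex.norm_exp_ofReal_mul_I]
    simp
  · refine Filter.Eventually.of_forall fun η => ?_
    unfold schrodingerSymbol
    fun_prop

theorem measurable_iSup_enorm_fourierInv {h : EuclideanSpace ℝ (Fin n) → ℂ} (h1 : Integrable h) :
    Measurable fun x : EuclideanSpace ℝ (Fin n) =>
      ⨆ t ∈ Set.Ioo (0 : ℝ) 1, ‖𝓕⁻ (fun η => schrodingerSymbol n t η * h η) x‖ₑ :=
  LowerSemicontinuous.measurable <| lowerSemicontinuous_biSup fun t _ =>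
    (continuous_fourierInv (integrable_schrodingerSymbol_mul t h1)).enorm.lowerSemicontinuous

/-- The Sobolev norm of a function whose Fourier transform is the indicator of a bounded set. -/
theorem sobolevNorm_fourierInv_indicator_le {s : ℝ} (hs : 0 ≤ s)
    {S : Set (EuclideanSpace ℝ (Fin n))} (hS : MeasurableSet S)
    (h2 : MemLp (S.indicator fun _ => (1 : ℂ)) 2 volume) {ρ : ℝ} (hρ : ∀ η ∈ S, ‖η‖ ≤ ρ) :
    sobolevNorm s (𝓕⁻ h2.toLp) ≤
      (ENNReal.ofReal ((1 + (2 * Real.pi * ρ) ^ 2) ^ s) * volume S) ^ (1 / 2 : ℝ) := by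
  unfold sobolevNorm
  gcongr
  rw [FourierTransform.fourier_fourierInv_eq, ← setLIntegral_const, ← lintegral_indicator hS]
  refine lintegral_mono_ae ?_
  filter_upwards [h2.coeFn_toLp] with η hη
  rw [hη]
  by_cases h : η ∈ S
  · have h0 : 0 ≤ ‖η‖ := norm_nonneg η
    have := hρ η h
    simp only [Set.indicator_of_mem h, enorm_one, one_pow, mul_one]
    gcongr
  · simp [h]

end Evolution

/-! ### Additive characters. -/

/-- The character `e(x) = e^{2πix}`. -/
noncomputable def unitExp (x : ℝ) : ℂ := Complex.exp (((2 * Real.pi * x : ℝ) : ℂ) * Complex.I)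

section UnitExp

theorem unitExp_add (x y : ℝ) : unitExp (x + y) = unitExp x * unitExp y := by
  rw [unitExp, unitExp, unitExp, ← Complex.exp_add]
  push_cast
  ring_nf

theorem norm_unitExp (x : ℝ) : ‖unitExp x‖ = 1 := by
  rw [unitExp, Complex.norm_exp_ofReal_mul_I]

theorem unitExp_zero : unitExp 0 = 1 := by simp [unitExp]

theorem unitExp_intCast (k : ℤ) : unitExp k = 1 := by
  rw [unitExp, Complex.exp_eq_one_iff]
  exact ⟨k, by push_cast; ring⟩

theorem unitExp_eq_one_iff (x : ℝ) : unitExp x = 1 ↔ ∃ k : ℤ, x = k := by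
  constructor
  · intro h
    rw [unitExp, Complex.exp_eq_one_iff] at h
    obtain ⟨k, hk⟩ := h
    refine ⟨k, ?_⟩
    have h2 : ((2 * Real.pi * x : ℝ) : ℂ) * Complex.I = ((2 * Real.pi * k : ℝ) : ℂ) * Complex.I := by
      rw [hk]; push_cast; ring
    have h3 := Complex.ofReal_injective (mul_right_cancel₀ Complex.I_ne_zero h2)
    exact mul_left_cancel₀ (by positivity) h3
  · rintro ⟨k, rfl⟩
    exact unitExp_intCast k

theorem unitExp_add_intCast (x : ℝ) (k : ℤ) : unitExp (x + k) = unitExp x := by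
  rw [unitExp_add, unitExp_intCast, mul_one]

theorem unitExp_neg (x : ℝ) : unitExp (-x) = starRingEnd ℂ (unitExp x) := by
  rw [unitExp, unitExp, ← Complex.exp_conj, map_mul, Complex.conj_ofReal, Complex.conj_I]
  push_cast
  ring_nf

theorem unitExp_nat_mul (k : ℕ) (x : ℝ) : unitExp (k * x) = unitExp x ^ k := by
  rw [unitExp, unitExp, ← Complex.exp_nat_mul]
  push_cast
  ring_nf

theorem continuous_unitExp : Continuous unitExp := by
  unfold unitExp
  fun_prop

@[fun_prop]
theorem Continuous.unitExp {α : Type*} [TopologicalSpace α] {f : α → ℝ} (hf : Continuous f) :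
    Continuous fun a => unitExp (f a) :=
  continuous_unitExp.comp hf

theorem re_unitExp (x : ℝ) : (unitExp x).re = Real.cos (2 * Real.pi * x) := by
  rw [unitExp, Complex.exp_ofReal_mul_I_re]

theorem half_le_re_unitExp {x : ℝ} (hx : |x| ≤ 1 / 6) : 1 / 2 ≤ (unitExp x).re := by
  rw [re_unitExp, ← Real.cos_abs, ← Real.cos_pi_div_three]
  have hp := Real.pi_pos
  refine Real.cos_le_cos_of_nonneg_of_le_pi (abs_nonneg _) (by linarith) ?_
  rw [abs_mul, abs_of_pos (by positivity)]
  nlinarith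

theorem norm_unitExp_sub_one_le (x : ℝ) : ‖unitExp x - 1‖ ≤ 2 * Real.pi * |x| := by
  have h := Real.norm_exp_I_mul_ofReal_sub_one_le (x := 2 * Real.pi * x)
  rw [Real.norm_eq_abs, abs_mul, abs_of_pos (by positivity : 0 < 2 * Real.pi)] at h
  rwa [unitExp, mul_comm]

theorem norm_unitExp_sub_one (x : ℝ) : ‖unitExp x - 1‖ = 2 * |Real.sin (Real.pi * x)| := by
  have h := Complex.norm_exp_I_mul_ofReal_sub_one (2 * Real.pi * x)
  rw [unitExp, mul_comm, h, norm_mul, Real.norm_eq_abs, Real.norm_eq_abs,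
    abs_of_pos (by norm_num : (0 : ℝ) < 2)]
  congr 3
  ring

end UnitExp

/-! ### Factorization of the evolution over coordinates. -/

section ProductSets

variable {n : ℕ}

theorem measurableSet_forall_coord_mem {S : Fin n → Set ℝ} (hS : ∀ j, MeasurableSet (S j)) :
    MeasurableSet {η : EuclideanSpace ℝ (Fin n) | ∀ j, η j ∈ S j} := by
  simp only [Set.ofPred_forall]
  exact MeasurableSet.iInter fun j => (by fun_prop : Measurable fun η : EuclideanSpace ℝ (Fin n) =>
    η j) (hS j)

theorem volume_forall_coord_mem {S : Fin n → Set ℝ} (hS : ∀ j, MeasurableSet (S j)) :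
    volume {η : EuclideanSpace ℝ (Fin n) | ∀ j, η j ∈ S j} = ∏ j, volume (S j) := by
  rw [← volume_pi_pi S, ← (EuclideanSpace.volume_preserving_symm_measurableEquiv_toLp
    (Fin n)).measure_preimage (MeasurableSet.univ_pi hS).nullMeasurableSet]
  congr 1
  ext η
  simp

/-- The evolution of a function whose Fourier transform is the indicator of a product set is a
product of one-dimensional oscillatory integrals. -/
theorem fourierInv_schrodingerSymbol_mul_indicator {S : Fin n → Set ℝ}
    (hS : ∀ j, MeasurableSet (S j)) (t : ℝ) (x : EuclideanSpace ℝ (Fin n)) :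
    𝓕⁻ (fun η => schrodingerSymbol n t η *
      {η : EuclideanSpace ℝ (Fin n) | ∀ j, η j ∈ S j}.indicator (fun _ => (1 : ℂ)) η) x =
      ∏ j, ∫ u in S j, unitExp (x j * u + 2 * Real.pi * t * u ^ 2) := by
  rw [Real.fourierInv_eq', ← (EuclideanSpace.volume_preserving_symm_measurableEquiv_toLp
    (Fin n)).symm.integral_comp']
  simp_rw [← integral_indicator (hS _)]
  rw [← integral_fintype_prod_volume_eq_prod (fun j => (S j).indicator
    fun u => unitExp (x j * u + 2 * Real.pi * t * u ^ 2))]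
  refine integral_congr_ae (Filter.Eventually.of_forall fun η => ?_)
  by_cases h : ∀ j, η j ∈ S j
  · have h' : ∀ j, (S j).indicator (fun u => unitExp (x j * u + 2 * Real.pi * t * u ^ 2)) (η j) =
        unitExp (x j * η j + 2 * Real.pi * t * η j ^ 2) := fun j => Set.indicator_of_mem (h j) _
    simp only [h']
    simp only [MeasurableEquiv.symm_symm, MeasurableEquiv.coe_toLp, Set.indicator, Set.mem_ofPred_eq,
      h, implies_true, if_true, unitExp, schrodingerSymbol, smul_eq_mul, mul_one]
    rw [← Complex.exp_add, ← Complex.exp_sum]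
    congr 1
    have hi : ∀ j, inner ℝ (η j) (x j) = x j * η j := fun j => by simp
    have hn : ∀ j, ‖η j‖ ^ 2 = η j ^ 2 := fun j => by simp
    rw [mul_pow, EuclideanSpace.norm_sq_eq, PiLp.inner_apply]
    simp only [hi, hn]
    push_cast
    simp only [Finset.mul_sum, Finset.sum_mul, ← Finset.sum_add_distrib]
    refine Finset.sum_congr rfl fun j _ => ?_
    ring
  · have h2 : (WithLp.toLp 2 η : EuclideanSpace ℝ (Fin n)) ∉
        {η : EuclideanSpace ℝ (Fin n) | ∀ j, η j ∈ S j} := h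
    simp only [MeasurableEquiv.symm_symm, MeasurableEquiv.coe_toLp, Set.indicator_of_notMem h2]
    push Not at h
    obtain ⟨j, hj⟩ := h
    rw [Finset.prod_eq_zero (Finset.mem_univ j) (Set.indicator_of_notMem hj _)]
    simp

end ProductSets

/-! ### Complete, incomplete and perturbed quadratic Gauss sums. -/

section GaussSums

theorem sum_range_add_of_periodic {M : Type*} [AddCommGroup M] {f : ℕ → M} {q : ℕ}
    (hf : ∀ l, f (l + q) = f l) (m : ℕ) :
    ∑ l ∈ Finset.range q, f (l + m) = ∑ l ∈ Finset.range q, f l := by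
  induction m with
  | zero => simp
  | succ m ih =>
    have h := Finset.sum_range_succ' (fun l => f (l + m)) q
    rw [Finset.sum_range_succ] at h
    have h2 : f (q + m) = f (0 + m) := by rw [zero_add, add_comm, hf]
    rw [h2] at h
    rw [← ih]
    have h3 := add_right_cancel h
    rw [h3]
    refine Finset.sum_congr rfl fun l _ => ?_
    congr 1
    ring

theorem sum_unitExp_div_mul {q : ℕ} (hq : 0 < q) (k : ℤ) :
    ∑ m ∈ Finset.range q, unitExp (m * (k / q)) = if (q : ℤ) ∣ k then (q : ℂ) else 0 := by
  simp_rw [unitExp_nat_mul]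
  have hq' : (q : ℝ) ≠ 0 := by positivity
  split_ifs with h
  · obtain ⟨j, rfl⟩ := h
    have : (((q : ℤ) * j : ℤ) : ℝ) / q = j := by
      push_cast
      field_simp
    rw [this, unitExp_intCast]
    simp
  · have h1 : unitExp (k / q) ≠ 1 := by
      rw [Ne, unitExp_eq_one_iff]
      rintro ⟨j, hj⟩
      apply h
      refine ⟨j, ?_⟩
      rw [div_eq_iff hq'] at hj
      have : k = j * q := by exact_mod_cast hj
      rw [this, mul_comm]
    rw [geom_sum_eq h1, ← unitExp_nat_mul]
    have : (q : ℝ) * (k / q) = k := by field_simp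
    rw [this, unitExp_intCast]
    simp

/-- The terms of the Gauss sum of the quadratic polynomial `(a l² + 2 b l) / (2 q)`. -/
noncomputable def gaussTerm (q : ℕ) (a b : ℤ) (l : ℕ) : ℂ :=
  unitExp ((a * l ^ 2 + 2 * b * l) / (2 * q))

variable {q : ℕ} {a : ℤ} (b : ℤ)

/-- Shifting `l` by `q` adds `a l + a q / 2 + b` to the phase; evenness of `a q` makes this an
integer. -/
theorem gaussTerm_add_period (hq : 0 < q) (haq : Even (a * q)) (l : ℕ) :
    gaussTerm q a b (l + q) = gaussTerm q a b l := by
  obtain ⟨j, hj⟩ := haq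
  have hj' : (a : ℝ) * q = j + j := by exact_mod_cast hj
  have hq' : (q : ℝ) ≠ 0 := by positivity
  unfold gaussTerm
  refine Eq.trans ?_ (unitExp_add_intCast _ (a * l + j + b))
  congr 1
  push_cast
  field_simp
  linear_combination (q : ℝ) * hj'

theorem norm_sum_gaussTerm (hq : 0 < q) (haq : Even (a * q)) (hc : IsCoprime a (q : ℤ)) :
    ‖∑ l ∈ Finset.range q, gaussTerm q a b l‖ = √q := by
  have hq' : (q : ℝ) ≠ 0 := by positivity
  -- Weyl differencing: with `l = h + m`, which periodicity allows, the sum over `m` is a full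
  -- character sum and vanishes unless `q` divides `a h`, that is, unless `h = 0`.
  have key : (starRingEnd ℂ) (∑ l ∈ Finset.range q, gaussTerm q a b l) *
      (∑ l ∈ Finset.range q, gaussTerm q a b l) = q := by
    have e1 : ∀ m h : ℕ, (starRingEnd ℂ) (gaussTerm q a b m) * gaussTerm q a b (h + m) =
        gaussTerm q a b h * unitExp (m * (((a * h : ℤ) : ℝ) / q)) := by
      intro m h
      unfold gaussTerm
      rw [← unitExp_neg, ← unitExp_add, ← unitExp_add]
      congr 1
      push_cast
      field_simp
      ring
    rw [map_sum, Finset.sum_mul]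
    have e2 : ∀ m ∈ Finset.range q, (starRingEnd ℂ) (gaussTerm q a b m) *
        (∑ l ∈ Finset.range q, gaussTerm q a b l) =
        ∑ h ∈ Finset.range q, gaussTerm q a b h * unitExp (m * (((a * h : ℤ) : ℝ) / q)) := by
      intro m _
      rw [← sum_range_add_of_periodic (gaussTerm_add_period b hq haq) m, Finset.mul_sum]
      exact Finset.sum_congr rfl fun h _ => e1 m h
    rw [Finset.sum_congr rfl e2, Finset.sum_comm]
    simp_rw [← Finset.mul_sum]
    rw [Finset.sum_eq_single_of_mem 0 (Finset.mem_range.2 hq)]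
    · simp [gaussTerm, unitExp_zero]
    · intro h hh h0
      rw [sum_unitExp_div_mul hq, if_neg, mul_zero]
      intro hd
      have := Int.le_of_dvd (by omega) (hc.symm.dvd_of_dvd_mul_left hd)
      have := Finset.mem_range.1 hh
      omega
  rw [← Real.sqrt_sq (norm_nonneg _)]
  congr 1
  rw [← Complex.normSq_eq_norm_sq]
  rw [← Complex.normSq_eq_conj_mul_self] at key
  exact_mod_cast key

/-- A geometric series, with the sine bounded below by Jordan's inequality from whichever of `0` and
`q` is nearer to `k`. Keeping both reciprocals avoids a minimum and turns the sum over `k` into two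
harmonic sums. -/
theorem norm_sum_unitExp_le {q : ℕ} {k : ℕ} (hk : 0 < k) (hkq : k < q) (r : ℕ) :
    ‖∑ m ∈ Finset.range r, unitExp (m * (-(k / q : ℝ)))‖ ≤
      q / 2 * (1 / k + 1 / ((q : ℝ) - k)) := by
  have hk' : (0 : ℝ) < k := by exact_mod_cast hk
  have hkq' : (k : ℝ) < q := by exact_mod_cast hkq
  have hq' : (0 : ℝ) < q := hk'.trans hkq'
  have hsub : (0 : ℝ) < q - k := sub_pos.2 hkq'
  have hp := Real.pi_pos
  have hsin : 0 < Real.sin (Real.pi * (k / q)) := by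
    apply Real.sin_pos_of_pos_of_lt_pi (by positivity)
    have : (k : ℝ) / q < 1 := (div_lt_one hq').2 hkq'
    nlinarith
  have hinv : 1 / Real.sin (Real.pi * (k / q)) ≤ q / 2 * (1 / k + 1 / ((q : ℝ) - k)) := by
    rcases le_total (2 * (k : ℝ)) q with h | h
    · have h1 : (k : ℝ) / q ≤ 1 / 2 := by rw [div_le_div_iff₀ hq' (by norm_num)]; linarith
      have := Real.mul_le_sin (x := Real.pi * (k / q)) (by positivity) (by nlinarith)
      have e : 2 / Real.pi * (Real.pi * (k / q)) = 2 * k / q := by field_simp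
      rw [e] at this
      calc 1 / Real.sin (Real.pi * (k / q)) ≤ 1 / (2 * k / q) :=
            one_div_le_one_div_of_le (by positivity) this
        _ = q / 2 * (1 / k) := by field_simp
        _ ≤ _ := by
            have : 0 ≤ 1 / ((q : ℝ) - k) := by positivity
            gcongr
            linarith
    · have h1 : ((q : ℝ) - k) / q ≤ 1 / 2 := by
        rw [div_le_div_iff₀ hq' (by norm_num)]; linarith
      have := Real.mul_le_sin (x := Real.pi * (((q : ℝ) - k) / q)) (by positivity) (by nlinarith)
      have e : 2 / Real.pi * (Real.pi * (((q : ℝ) - k) / q)) = 2 * (q - k) / q := by field_simp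
      have e2 : Real.pi * (((q : ℝ) - k) / q) = Real.pi - Real.pi * (k / q) := by field_simp
      rw [e, e2, Real.sin_pi_sub] at this
      calc 1 / Real.sin (Real.pi * (k / q)) ≤ 1 / (2 * (q - k) / q) :=
            one_div_le_one_div_of_le (by positivity) this
        _ = q / 2 * (1 / (q - k)) := by field_simp
        _ ≤ _ := by
            have : 0 ≤ 1 / (k : ℝ) := by positivity
            gcongr
            linarith
  refine le_trans ?_ hinv
  have hn : ‖unitExp (-(k / q : ℝ)) - 1‖ = 2 * Real.sin (Real.pi * (k / q)) := by
    rw [norm_unitExp_sub_one, mul_neg, Real.sin_neg, abs_neg, abs_of_pos hsin]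
  have h1 : unitExp (-(k / q : ℝ)) ≠ 1 := by
    intro h
    rw [h, sub_self, norm_zero] at hn
    linarith
  simp_rw [unitExp_nat_mul]
  rw [geom_sum_eq h1, norm_div, hn, div_le_div_iff₀ (by positivity) hsin, one_mul]
  gcongr
  calc _ ≤ ‖unitExp (-(k / q : ℝ)) ^ r‖ + ‖(1 : ℂ)‖ := norm_sub_le _ _
    _ = 2 := by rw [norm_pow, norm_unitExp, one_pow, norm_one]; norm_num

theorem sum_norm_sum_unitExp_le {q : ℕ} (hq : 0 < q) {r : ℕ} (hr : r ≤ q) :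
    ∑ k ∈ Finset.range q, ‖∑ m ∈ Finset.range r, unitExp (m * (-(k / q : ℝ)))‖ ≤
      q * (2 + Real.log q) := by
  obtain ⟨p, rfl⟩ := Nat.exists_eq_succ_of_ne_zero hq.ne'
  rw [Finset.sum_range_succ']
  have h0 : ‖∑ m ∈ Finset.range r, unitExp (m * (-((0 : ℕ) / (p.succ : ℕ) : ℝ)))‖ ≤
      (p.succ : ℕ) := by
    simp only [Nat.cast_zero, zero_div, neg_zero, mul_zero, unitExp_zero]
    simpa using (by exact_mod_cast hr : (r : ℝ) ≤ (p.succ : ℕ))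
  have h1 : ∑ k ∈ Finset.range p,
      ‖∑ m ∈ Finset.range r, unitExp (m * (-((k + 1 : ℕ) / (p.succ : ℕ) : ℝ)))‖ ≤
      ∑ k ∈ Finset.range p, ((p.succ : ℕ) : ℝ) / 2 *
        (1 / (k + 1 : ℕ) + 1 / (((p.succ : ℕ) : ℝ) - (k + 1 : ℕ))) :=
    Finset.sum_le_sum fun k hk => norm_sum_unitExp_le (Nat.succ_pos k)
      (by have := Finset.mem_range.1 hk; omega) r
  have h2 : ∑ k ∈ Finset.range p, (1 / (((p.succ : ℕ) : ℝ) - (k + 1 : ℕ))) =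
      ∑ k ∈ Finset.range p, (1 / ((k + 1 : ℕ) : ℝ)) := by
    rw [← Finset.sum_range_reflect]
    refine Finset.sum_congr rfl fun k hk => ?_
    have hk := Finset.mem_range.1 hk
    congr 1
    rw [sub_eq_iff_eq_add]
    norm_cast
    omega
  have h3 : ∑ k ∈ Finset.range p, (1 / ((k + 1 : ℕ) : ℝ)) ≤ 1 + Real.log p.succ := by
    have h := harmonic_le_one_add_log p.succ
    rw [harmonic, Finset.sum_range_succ] at h
    push_cast at h ⊢
    simp only [one_div]
    have : (0 : ℝ) ≤ ((p : ℝ) + 1)⁻¹ := by positivity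
    linarith
  rw [← Finset.mul_sum, Finset.sum_add_distrib, h2] at h1
  have hp : (0 : ℝ) < (p.succ : ℕ) := by exact_mod_cast hq
  have := mul_le_mul_of_nonneg_left h3 hp.le
  push_cast at *
  linarith

/-- Incomplete Gauss sums, by completion. -/
theorem norm_sum_gaussTerm_le (hq : 0 < q) (haq : Even (a * q)) (hc : IsCoprime a (q : ℤ))
    {r : ℕ} (hr : r ≤ q) :
    ‖∑ l ∈ Finset.range r, gaussTerm q a b l‖ ≤ √q * (2 + Real.log q) := by
  have hq' : (0 : ℝ) < q := by exact_mod_cast hq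
  -- Averaging `e(k (l - m) / q)` over `k` detects `l = m`. The frequency `k` only changes `b` to `b
  -- + k`, so every complete sum that appears has modulus `√q`.
  have key : (q : ℂ) * ∑ l ∈ Finset.range r, gaussTerm q a b l =
      ∑ k ∈ Finset.range q, (∑ m ∈ Finset.range r, unitExp (m * (-(k / q : ℝ)))) *
        ∑ l ∈ Finset.range q, gaussTerm q a (b + k) l := by
    have e : ∀ k m l : ℕ, unitExp (m * (-(k / q : ℝ))) * gaussTerm q a (b + k) l =
        gaussTerm q a b l * unitExp (k * (((l - m : ℤ) : ℝ) / q)) := by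
      intro k m l
      unfold gaussTerm
      rw [← unitExp_add, ← unitExp_add]
      congr 1
      push_cast
      field_simp
      ring
    simp_rw [Finset.sum_mul_sum, e]
    rw [Finset.sum_comm, Finset.mul_sum]
    refine Finset.sum_congr rfl fun m hm => ?_
    have hm := Finset.mem_range.1 hm
    rw [Finset.sum_comm]
    simp_rw [← Finset.mul_sum, sum_unitExp_div_mul hq]
    rw [Finset.sum_eq_single_of_mem m (Finset.mem_range.2 (hm.trans_le hr))]
    · simp [mul_comm]
    · intro l hl hlm
      have hl := Finset.mem_range.1 hl
      rw [if_neg, mul_zero]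
      rintro ⟨j, hj⟩
      rcases lt_trichotomy j 0 with h | h | h
      · nlinarith
      · subst h; omega
      · nlinarith
  have h1 : (q : ℝ) * ‖∑ l ∈ Finset.range r, gaussTerm q a b l‖ ≤
      q * (2 + Real.log q) * √q := by
    have : (q : ℝ) * ‖∑ l ∈ Finset.range r, gaussTerm q a b l‖ =
        ‖(q : ℂ) * ∑ l ∈ Finset.range r, gaussTerm q a b l‖ := by
      rw [norm_mul, Complex.norm_natCast]
    rw [this, key]
    refine (norm_sum_le _ _).trans ?_
    simp_rw [norm_mul, norm_sum_gaussTerm (b + _) hq haq hc]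
    rw [← Finset.sum_mul]
    exact mul_le_mul_of_nonneg_right (sum_norm_sum_unitExp_le hq hr) (Real.sqrt_nonneg _)
  have h2 : (q : ℝ) * (2 + Real.log q) * √q = q * (√q * (2 + Real.log q)) := by ring
  rw [h2] at h1
  exact le_of_mul_le_mul_left h1 hq'

theorem sum_range_mul_add_of_periodic {f : ℕ → ℂ} {q : ℕ} (hf : ∀ l, f (l + q) = f l) (k r : ℕ) :
    ∑ l ∈ Finset.range (q * k + r), f l =
      k * ∑ l ∈ Finset.range q, f l + ∑ l ∈ Finset.range r, f l := by
  induction k with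
  | zero => simp
  | succ k ih =>
    have e : q * (k + 1) + r = q * k + r + q := by ring
    rw [e, Finset.sum_range_add, ih]
    have h := sum_range_add_of_periodic hf (q * k + r)
    simp_rw [add_comm _ (q * k + r)] at h
    rw [h]
    push_cast
    ring

/-- Once the mean over a period is subtracted, whole periods cancel and only a block shorter than
`q` remains, so the bound is uniform in `M`. -/
theorem norm_sum_gaussTerm_sub_le (hq : 0 < q) (haq : Even (a * q)) (hc : IsCoprime a (q : ℤ))
    (M : ℕ) :
    ‖∑ l ∈ Finset.range M, (gaussTerm q a b l -
      (∑ l ∈ Finset.range q, gaussTerm q a b l) / q)‖ ≤ √q * (3 + Real.log q) := by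
  have hq' : (0 : ℝ) < q := by exact_mod_cast hq
  have hqc : (q : ℂ) ≠ 0 := by exact_mod_cast hq.ne'
  have hr : M % q < q := Nat.mod_lt _ hq
  have e : ∑ l ∈ Finset.range M, (gaussTerm q a b l -
      (∑ l ∈ Finset.range q, gaussTerm q a b l) / q) =
      ∑ l ∈ Finset.range (M % q), gaussTerm q a b l -
        ((M % q : ℕ) / q : ℂ) * ∑ l ∈ Finset.range q, gaussTerm q a b l := by
    rw [Finset.sum_sub_distrib, Finset.sum_const, Finset.card_range]
    conv_lhs => rw [← Nat.div_add_mod M q]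
    rw [sum_range_mul_add_of_periodic (gaussTerm_add_period b hq haq)]
    simp only [nsmul_eq_mul]
    push_cast
    field_simp
    ring
  rw [e]
  refine (norm_sub_le _ _).trans ?_
  have h1 := norm_sum_gaussTerm_le b hq haq hc hr.le
  have h2 : ‖((M % q : ℕ) / q : ℂ) * ∑ l ∈ Finset.range q, gaussTerm q a b l‖ ≤ √q := by
    rw [norm_mul, norm_sum_gaussTerm b hq haq hc, norm_div, Complex.norm_natCast,
      Complex.norm_natCast]
    have : ((M % q : ℕ) : ℝ) / q ≤ 1 := (div_le_one hq').2 (by exact_mod_cast hr.le)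
    exact mul_le_of_le_one_left (Real.sqrt_nonneg _) this
  linarith

/-- Gauss sums with a slowly varying linear phase. -/
theorem norm_sum_gaussTerm_mul_unitExp_sub_le (hq : 0 < q) (haq : Even (a * q))
    (hc : IsCoprime a (q : ℤ)) (L : ℕ) (θ : ℝ) :
    ‖∑ l ∈ Finset.range L, gaussTerm q a b l * unitExp (l * θ) -
      (∑ l ∈ Finset.range q, gaussTerm q a b l) / q * ∑ l ∈ Finset.range L, unitExp (l * θ)‖ ≤
      (1 + L * (2 * Real.pi * |θ|)) * (√q * (3 + Real.log q)) := by
  set g := (∑ l ∈ Finset.range q, gaussTerm q a b l) / q with hg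
  set B := √q * (3 + Real.log q) with hB
  have hT : ∀ M, ‖∑ l ∈ Finset.range M, (gaussTerm q a b l - g)‖ ≤ B :=
    norm_sum_gaussTerm_sub_le b hq haq hc
  have hB0 : 0 ≤ B := (norm_nonneg _).trans (hT 0)
  have e : ∑ l ∈ Finset.range L, gaussTerm q a b l * unitExp (l * θ) -
      g * ∑ l ∈ Finset.range L, unitExp (l * θ) =
      -- Summation by parts: the partial sums of the mean-free terms are at most `B`, and the phase
      -- has total variation at most `L * (2π|θ|)`.
      ∑ l ∈ Finset.range L, unitExp (l * θ) • (gaussTerm q a b l - g) := by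
    rw [Finset.mul_sum, ← Finset.sum_sub_distrib]
    exact Finset.sum_congr rfl fun l _ => by rw [smul_eq_mul]; ring
  rw [e, Finset.sum_range_by_parts]
  refine (norm_sub_le _ _).trans ?_
  rw [add_mul, one_mul]
  gcongr
  · rw [norm_smul, norm_unitExp, one_mul]
    exact hT _
  · refine (norm_sum_le _ _).trans ?_
    have h : ∀ i ∈ Finset.range (L - 1),
        ‖(unitExp ((i + 1 : ℕ) * θ) - unitExp (i * θ)) •
          ∑ l ∈ Finset.range (i + 1), (gaussTerm q a b l - g)‖ ≤ 2 * Real.pi * |θ| * B := by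
      intro i _
      rw [norm_smul]
      refine mul_le_mul ?_ (hT _) (norm_nonneg _) (by positivity)
      have : unitExp ((i + 1 : ℕ) * θ) - unitExp (i * θ) =
          unitExp (i * θ) * (unitExp θ - 1) := by
        push_cast
        rw [add_mul, one_mul, unitExp_add]
        ring
      rw [this, norm_mul, norm_unitExp, one_mul]
      exact norm_unitExp_sub_one_le θ
    refine (Finset.sum_le_sum h).trans ?_
    rw [Finset.sum_const, Finset.card_range, nsmul_eq_mul, ← mul_assoc]
    gcongr
    omega

end GaussSums

/-! ### Lower bounds for the one-dimensional oscillatory integrals. -/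

section OscillatoryIntegrals

theorem mul_measureReal_le_norm_setIntegral {S : Set ℝ} (hS : MeasurableSet S)
    (hfin : volume S ≠ ∞) {f : ℝ → ℂ} (hf : IntegrableOn f S) {c : ℝ}
    (hc : ∀ u ∈ S, c ≤ (f u).re) : c * volume.real S ≤ ‖∫ u in S, f u‖ := by
  refine le_trans ?_ (Complex.re_le_norm _)
  have h : (∫ u in S, f u).re = ∫ u in S, (f u).re := by
    have := integral_re (𝕜 := ℂ) hf
    exact this.symm
  rw [h]
  have h2 : ∫ _ in S, c = c * volume.real S := by
    rw [setIntegral_const, smul_eq_mul, mul_comm]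
  rw [← h2]
  exact setIntegral_mono_on (integrableOn_const hfin) hf.re hS hc

theorem integrableOn_Ico_of_continuous {f : ℝ → ℂ} (hf : Continuous f) (a b : ℝ) :
    IntegrableOn f (Set.Ico a b) :=
  (hf.integrableOn_Icc).mono_set Set.Ico_subset_Icc_self

/-- There is no cancellation in the integral of a nearly constant phase. -/
theorem half_le_norm_integral_unitExp {x τ R w : ℝ} (hw : 0 ≤ w)
    (h1 : |x - 2 * R * τ| * w ≤ 1 / 12) (hτ : 0 ≤ τ) (h2 : τ * w ^ 2 ≤ 1 / 12) :
    w / 2 ≤ ‖∫ u in Set.Ico (-R) (-R + w), unitExp (x * u + τ * u ^ 2)‖ := by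
  -- Recentring at `-R` replaces the linear frequency `x` by `x - 2 R τ`.
  have e : ∀ u : ℝ, unitExp (x * u + τ * u ^ 2) = unitExp (-(R * x) + τ * R ^ 2) *
      unitExp ((x - 2 * R * τ) * (u + R) + τ * (u + R) ^ 2) := by
    intro u
    rw [← unitExp_add]
    congr 1
    ring
  simp_rw [e]
  rw [integral_const_mul, norm_mul, norm_unitExp, one_mul]
  have hvol : volume.real (Set.Ico (-R) (-R + w)) = w := by
    rw [Real.volume_real_Ico_of_le (by linarith)]
    ring
  have := mul_measureReal_le_norm_setIntegral (c := 1 / 2) measurableSet_Ico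
    (by simp) (integrableOn_Ico_of_continuous (f := fun u => unitExp ((x - 2 * R * τ) * (u + R) +
      τ * (u + R) ^ 2)) (by fun_prop) (-R) (-R + w)) ?_
  · rw [hvol] at this
    linarith
  · rintro u ⟨hu1, hu2⟩
    apply half_le_re_unitExp
    have h0 : 0 ≤ u + R := by linarith
    have hle : u + R ≤ w := by linarith
    calc _ ≤ |(x - 2 * R * τ) * (u + R)| + |τ * (u + R) ^ 2| := abs_add_le _ _
      _ = |x - 2 * R * τ| * (u + R) + τ * (u + R) ^ 2 := by
          rw [abs_mul, abs_of_nonneg h0, abs_of_nonneg (by positivity : 0 ≤ τ * (u + R) ^ 2)]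
      _ ≤ |x - 2 * R * τ| * w + τ * w ^ 2 := by gcongr
      _ ≤ 1 / 6 := by linarith

theorem pairwiseDisjoint_Ico_mul {D c : ℝ} (hD : c ≤ D) (hD0 : 0 ≤ D) (S : Set ℕ) :
    S.PairwiseDisjoint fun l : ℕ => Set.Ico (D * l) (D * l + c) := by
  have h : ∀ u v : ℕ, u < v → D * u + c ≤ D * v := by
    intro u v huv
    have h2 : (u : ℝ) + 1 ≤ v := by exact_mod_cast huv
    nlinarith
  intro u _ v _ huv
  rcases lt_or_gt_of_ne huv with huv | huv
  · exact Set.disjoint_left.2 fun x hx hx' => absurd (hx.2.trans_le (h u v huv)) (not_lt.2 hx'.1)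
  · exact Set.disjoint_left.2 fun x hx hx' => absurd (hx'.2.trans_le (h v u huv)) (not_lt.2 hx.1)

theorem integral_biUnion_Ico_mul {D c : ℝ} (hD : c ≤ D) (hD0 : 0 ≤ D) (L : ℕ) {f : ℝ → ℂ}
    (hf : Continuous f) :
    ∫ u in ⋃ l ∈ Finset.range L, Set.Ico (D * l) (D * l + c), f u =
      ∫ u in Set.Ico 0 c, ∑ l ∈ Finset.range L, f (D * l + u) := by
  rw [integral_biUnion_finset _ (fun _ _ => measurableSet_Ico) (pairwiseDisjoint_Ico_mul hD hD0 _)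
    fun _ _ => integrableOn_Ico_of_continuous hf _ _, integral_finsetSum]
  · refine Finset.sum_congr rfl fun l _ => ?_
    have h := (measurePreserving_add_left (volume : Measure ℝ) (D * l)).setIntegral_preimage_emb
      (measurableEmbedding_addLeft (D * l)) f (Set.Ico (D * l) (D * l + c))
    rw [← h]
    simp
  · intro l _
    exact integrableOn_Ico_of_continuous (hf.comp (by fun_prop)) _ _

/-- Lower bound for the evolution of a sum of bumps at lattice frequencies, near a rational
point. -/
theorem le_norm_integral_lattice {q L : ℕ} {a b : ℤ} (hq : 0 < q) (haq : Even (a * q))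
    (hc : IsCoprime a (q : ℤ)) {x τ D : ℝ} (hx0 : 0 ≤ x) (hx1 : x ≤ 1) (hτ0 : 0 ≤ τ) (hτ1 : τ ≤ 1)
    (hD : 1 ≤ D) (hτD : τ * D ^ 2 = a / (2 * q)) (hτL : 2 * τ * (D * L) ≤ 1)
    (hx : L * |x * D - b / q| ≤ 1 / 16) :
    1 / 32 * (L / (2 * √q) - 2 * (√q * (3 + Real.log q))) ≤
      ‖∫ u in ⋃ l ∈ Finset.range L, Set.Ico (D * l) (D * l + 1 / 32),
        unitExp (x * u + τ * u ^ 2)‖ := by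
  have hq' : (0 : ℝ) < q := by exact_mod_cast hq
  set δ := x * D - b / q with hδ
  set g := (∑ l ∈ Finset.range q, gaussTerm q a b l) / q with hg
  set B := √q * (3 + Real.log q) with hB
  have hB0 : 0 ≤ B := (norm_nonneg _).trans (norm_sum_gaussTerm_sub_le b hq haq hc 0)
  have hgn : ‖g‖ = 1 / √q := by
    rw [hg, norm_div, norm_sum_gaussTerm b hq haq hc, Complex.norm_natCast, Real.sqrt_div_self,
      one_div]
  -- In the phase at `D l + u`, the `l²` term and `b l / q` make up the Gauss term, `x u + τ u²`
  -- does not depend on `l`, and `θ u` is the remaining coefficient of `l`, of size `O(1 / L)`.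
  let θ : ℝ → ℝ := fun u => δ + 2 * τ * D * u
  have hθc : Continuous θ := by fun_prop
  have hθ : ∀ u ∈ Set.Ico (0 : ℝ) (1 / 32), L * |θ u| ≤ 3 / 32 := by
    rintro u ⟨hu0, hu1⟩
    have hL0 : (0 : ℝ) ≤ L := Nat.cast_nonneg L
    have hD0 : 0 ≤ D := by linarith
    calc L * |θ u| ≤ L * (|δ| + |2 * τ * D * u|) := by gcongr; exact abs_add_le _ _
      _ = L * |δ| + 2 * τ * (D * L) * u := by
          rw [abs_of_nonneg (by positivity : 0 ≤ 2 * τ * D * u)]; ring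
      _ ≤ 1 / 16 + 1 * (1 / 32) := by gcongr
      _ = 3 / 32 := by norm_num
  have hψ : ∀ u ∈ Set.Ico (0 : ℝ) (1 / 32), |x * u + τ * u ^ 2| ≤ 1 / 16 := by
    rintro u ⟨hu0, hu1⟩
    rw [abs_of_nonneg (by positivity)]
    have : x * u ≤ 1 * (1 / 32) := by gcongr
    have : τ * u ^ 2 ≤ 1 * (1 / 32) ^ 2 := by gcongr
    linarith
  rw [integral_biUnion_Ico_mul (by linarith) (by linarith) L
    (f := fun u => unitExp (x * u + τ * u ^ 2)) (by fun_prop)]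
  -- `g F` is the main term, with the Gauss terms replaced by their mean; `E` is the error.
  let F : ℝ → ℂ := fun u => ∑ l ∈ Finset.range L, unitExp (x * u + τ * u ^ 2 + l * θ u)
  let E : ℝ → ℂ := fun u => unitExp (x * u + τ * u ^ 2) *
    (∑ l ∈ Finset.range L, gaussTerm q a b l * unitExp (l * θ u) -
      g * ∑ l ∈ Finset.range L, unitExp (l * θ u))
  have hFc : Continuous F := by fun_prop
  have hEc : Continuous E := by fun_prop
  have e : ∀ u : ℝ, ∑ l ∈ Finset.range L, unitExp (x * (D * l + u) + τ * (D * l + u) ^ 2) =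
      g * F u + E u := by
    intro u
    have e1 : ∀ l : ℕ, unitExp (x * (D * l + u) + τ * (D * l + u) ^ 2) =
        unitExp (x * u + τ * u ^ 2) * (gaussTerm q a b l * unitExp (l * θ u)) := by
      intro l
      unfold gaussTerm
      rw [← unitExp_add, ← unitExp_add]
      congr 1
      have : ((a : ℝ) * l ^ 2 + 2 * b * l) / (2 * q) = a / (2 * q) * l ^ 2 + b / q * l := by
        field_simp
      rw [this, ← hτD]
      simp only [θ, hδ]
      ring
    simp only [e1, ← Finset.mul_sum, F, E, unitExp_add (x * u + τ * u ^ 2)]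
    ring
  simp_rw [e]
  rw [integral_add (integrableOn_Ico_of_continuous (by fun_prop) _ _)
    (integrableOn_Ico_of_continuous hEc _ _), integral_const_mul]
  have hvol : volume.real (Set.Ico (0 : ℝ) (1 / 32)) = 1 / 32 := by
    rw [Real.volume_real_Ico_of_le (by norm_num), sub_zero]
  have hF : (L / 2 : ℝ) * (1 / 32) ≤ ‖∫ u in Set.Ico (0 : ℝ) (1 / 32), F u‖ := by
    refine le_of_eq_of_le (by rw [hvol]) (mul_measureReal_le_norm_setIntegral (c := L / 2)
      measurableSet_Ico (by simp) (integrableOn_Ico_of_continuous hFc _ _) fun u hu => ?_)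
    simp only [F, Complex.re_sum]
    have : ∀ l ∈ Finset.range L, (1 / 2 : ℝ) ≤ (unitExp (x * u + τ * u ^ 2 + l * θ u)).re := by
      intro l hl
      have hl : (l : ℝ) ≤ L := by exact_mod_cast (Finset.mem_range.1 hl).le
      apply half_le_re_unitExp
      calc _ ≤ |x * u + τ * u ^ 2| + |l * θ u| := abs_add_le _ _
        _ = |x * u + τ * u ^ 2| + l * |θ u| := by rw [abs_mul, Nat.abs_cast]
        _ ≤ 1 / 16 + L * |θ u| := by gcongr; exact hψ u hu
        _ ≤ 1 / 6 := by have := hθ u hu; linarith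
    have h2 := Finset.sum_le_sum this
    rw [Finset.sum_const, Finset.card_range, nsmul_eq_mul] at h2
    linarith
  have hE : ‖∫ u in Set.Ico (0 : ℝ) (1 / 32), E u‖ ≤ 2 * B * (1 / 32) := by
    refine (norm_setIntegral_le_of_norm_le_const (C := 2 * B) (by simp) fun u hu => ?_).trans_eq
      (by rw [hvol])
    simp only [E]
    rw [norm_mul, norm_unitExp, one_mul]
    refine (norm_sum_gaussTerm_mul_unitExp_sub_le b hq haq hc L (θ u)).trans ?_
    gcongr
    -- The factor `1 + L * (2π|θ|)` is below `2` because `2π * 3/32 < 1`.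
    have := hθ u hu
    have hp := Real.pi_lt_four
    have hp0 := Real.pi_pos
    nlinarith
  have h3 := norm_sub_le_norm_add (g * ∫ u in Set.Ico (0 : ℝ) (1 / 32), F u)
    (∫ u in Set.Ico (0 : ℝ) (1 / 32), E u)
  rw [norm_mul, hgn] at h3
  have h4 : 1 / √q * ((L / 2 : ℝ) * (1 / 32)) ≤ 1 / √q * ‖∫ u in Set.Ico (0 : ℝ) (1 / 32), F u‖ := by
    gcongr
  have h5 : 1 / √q * ((L / 2 : ℝ) * (1 / 32)) = 1 / 32 * (L / (2 * √q)) := by ring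
  linarith

end OscillatoryIntegrals

/-! ### Simultaneous approximation with large denominators. -/

section Dirichlet

/-- Dirichlet's theorem on simultaneous approximation. -/
theorem exists_nat_forall_abs_mul_sub_lt {d : ℕ} (y : Fin d → ℝ) {P : ℕ} (hP : 0 < P) :
    ∃ q : ℕ, 0 < q ∧ q ≤ P ^ d ∧ ∃ b : Fin d → ℤ, ∀ j, |q * y j - b j| < 1 / P := by
  have hP' : (0 : ℝ) < P := by exact_mod_cast hP
  -- Pigeonhole: `f k` names the box of side `1 / P` containing the fractional parts of `k y`; there
  -- are `P^d` boxes for `P^d + 1` values of `k`.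
  let f : ℕ → Fin d → ℕ := fun k j => ⌊Int.fract (k * y j) * P⌋₊
  have hlt : (Fintype.piFinset fun _ : Fin d => Finset.range P).card <
      (Finset.range (P ^ d + 1)).card := by
    simp [Fintype.card_piFinset]
  obtain ⟨k, hk, l, hl, hkl, he⟩ := Finset.exists_ne_map_eq_of_card_lt_of_maps_to hlt
    (f := f) (fun k _ => by
      simp only [Fintype.coe_piFinset, Set.mem_univ_pi, Finset.coe_range, Set.mem_Iio, f]
      intro j
      rw [Nat.floor_lt (mul_nonneg (Int.fract_nonneg _) hP'.le)]
      exact mul_lt_of_lt_one_left hP' (Int.fract_lt_one _))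
  have key : ∀ k l : ℕ, k < l → l ≤ P ^ d → f k = f l → ∃ q : ℕ, 0 < q ∧ q ≤ P ^ d ∧
      ∃ b : Fin d → ℤ, ∀ j, |q * y j - b j| < 1 / P := by
    intro k l hkl hl he
    refine ⟨l - k, by omega, by omega, fun j => ⌊l * y j⌋ - ⌊k * y j⌋, fun j => ?_⟩
    have e : ((l - k : ℕ) : ℝ) * y j - ((⌊l * y j⌋ - ⌊k * y j⌋ : ℤ) : ℝ) =
        Int.fract (l * y j) - Int.fract (k * y j) := by
      rw [Nat.cast_sub hkl.le, Int.fract, Int.fract]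
      push_cast
      ring
    have hf := congrFun he j
    simp only [f] at hf
    have h1 := Nat.floor_le (mul_nonneg (Int.fract_nonneg ((k : ℝ) * y j)) hP'.le)
    have h2 := Nat.lt_floor_add_one (Int.fract ((k : ℝ) * y j) * P)
    have h3 := Nat.floor_le (mul_nonneg (Int.fract_nonneg ((l : ℝ) * y j)) hP'.le)
    have h4 := Nat.lt_floor_add_one (Int.fract ((l : ℝ) * y j) * P)
    rw [hf] at h1 h2
    rw [e, abs_lt, ← neg_div, div_lt_iff₀ hP', lt_div_iff₀ hP', sub_mul]
    constructor <;> linarith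
  rcases lt_or_gt_of_ne hkl with h | h
  · exact key k l h (by have := Finset.mem_range.1 hl; omega) he
  · exact key l k h (by have := Finset.mem_range.1 hk; omega) he.symm

/-- At most `2 E r` integers `b` matter, each contributing an interval of length `2 / (P E)`; `E r ≥
2` absorbs the endpoint terms. -/
theorem volume_setOf_abs_mul_sub_lt_le {E r : ℝ} (hr : 0 < r) (hE : 2 ≤ E * r) {P : ℕ}
    (hP : 0 < P) :
    volume {x : ℝ | x ∈ Set.Icc 0 r ∧ ∃ b : ℤ, |E * x - b| < 1 / P} ≤
      ENNReal.ofReal (4 * r / P) := by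
  have hP' : (1 : ℝ) ≤ P := by exact_mod_cast hP
  have hE0 : 0 < E := by
    by_contra! h
    nlinarith
  have hP1 : (1 : ℝ) / P ≤ 1 := (div_le_one (by linarith)).2 hP'
  have hsub : {x : ℝ | x ∈ Set.Icc 0 r ∧ ∃ b : ℤ, |E * x - b| < 1 / P} ⊆
      ⋃ b ∈ Finset.range (⌈E * r⌉₊ + 1),
        Set.Icc ((b - 1 / P) / E : ℝ) ((b + 1 / P) / E) := by
    rintro x ⟨⟨hx0, hxr⟩, b, hb⟩
    rw [abs_lt] at hb
    have hEx : E * x ≤ E * r := by gcongr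
    have hEx0 : 0 ≤ E * x := by positivity
    have hb0 : 0 ≤ b := by
      have : (-1 : ℝ) < b := by linarith
      have : -1 < b := by exact_mod_cast this
      omega
    obtain ⟨c, rfl⟩ := Int.eq_ofNat_of_zero_le hb0
    simp only [Set.mem_iUnion, Finset.mem_range, Set.mem_Icc, exists_prop]
    simp only [Int.cast_natCast] at hb
    refine ⟨c, ?_, ?_, ?_⟩
    · have : (c : ℝ) < ⌈E * r⌉₊ + 1 := by
        have := Nat.le_ceil (E * r)
        linarith
      exact_mod_cast this
    · rw [div_le_iff₀ hE0]; linarith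
    · rw [le_div_iff₀ hE0]; linarith
  refine (measure_mono hsub).trans ((measure_biUnion_finset_le _ _).trans ?_)
  have e : ∀ b : ℕ, volume (Set.Icc ((b - 1 / P) / E : ℝ) ((b + 1 / P) / E)) =
      ENNReal.ofReal (2 / (P * E)) := by
    intro b
    rw [Real.volume_Icc]
    congr 1
    field_simp
    ring
  simp_rw [e]
  rw [Finset.sum_const, Finset.card_range, ← ENNReal.ofReal_nsmul, nsmul_eq_mul]
  refine ENNReal.ofReal_le_ofReal ?_
  have hc : ((⌈E * r⌉₊ + 1 : ℕ) : ℝ) ≤ 2 * (E * r) := by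
    have := (Nat.ceil_lt_add_one (by linarith : 0 ≤ E * r)).le
    push_cast
    linarith
  calc ((⌈E * r⌉₊ + 1 : ℕ) : ℝ) * (2 / (P * E)) ≤ 2 * (E * r) * (2 / (P * E)) := by gcongr
    _ = 4 * r / P := by field_simp; ring

theorem measurableSet_setOf_abs_mul_sub_lt (E r δ : ℝ) :
    MeasurableSet {x : ℝ | x ∈ Set.Icc 0 r ∧ ∃ b : ℤ, |E * x - b| < δ} := by
  have : {x : ℝ | x ∈ Set.Icc 0 r ∧ ∃ b : ℤ, |E * x - b| < δ} =
      Set.Icc 0 r ∩ ⋃ b : ℤ, {x : ℝ | |E * x - b| < δ} := by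
    ext x; simp
  rw [this]
  refine measurableSet_Icc.inter (MeasurableSet.iUnion fun b => ?_)
  exact measurableSet_lt (by fun_prop) measurable_const

/-- Most points of a cube have Dirichlet approximations with large denominators. -/
theorem exists_measurableSet_approximable {d : ℕ} {D r : ℝ} (hr : 0 < r)
    (hD : 2 ≤ D * r) {P : ℕ} (hP : 0 < P) :
    ∃ G : Set (Fin d → ℝ), MeasurableSet G ∧ ENNReal.ofReal (r ^ d / 2) ≤ volume G ∧
      ∀ x ∈ G, (∀ j, x j ∈ Set.Icc 0 r) ∧ ∃ q : ℕ, q ≤ P ^ d ∧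
        (P : ℝ) ^ d / (2 * 4 ^ d) < q ∧ ∃ b : Fin d → ℤ, ∀ j, |q * (D * x j) - b j| < 1 / P := by
  have hP' : (0 : ℝ) < P := by exact_mod_cast hP
  -- The threshold is chosen so that the `N` sets `B q`, of measure at most `(4 r / P)^d` each,
  -- cover at most half of the cube.
  let N := ⌊(P : ℝ) ^ d / (2 * 4 ^ d)⌋₊
  let B : ℕ → Set (Fin d → ℝ) := fun q => Set.univ.pi fun _ =>
    {x : ℝ | x ∈ Set.Icc 0 r ∧ ∃ b : ℤ, |q * D * x - b| < 1 / P}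
  have hBm : ∀ q, MeasurableSet (B q) := fun q =>
    MeasurableSet.univ_pi fun _ => measurableSet_setOf_abs_mul_sub_lt _ _ _
  have hBv : ∀ q ∈ Finset.Icc 1 N, volume (B q) ≤ ENNReal.ofReal ((4 * r / P) ^ d) := by
    intro q hq
    rw [volume_pi_pi]
    refine (Finset.prod_le_prod' fun _ _ => volume_setOf_abs_mul_sub_lt_le (P := P) hr ?_ hP).trans ?_
    · have : (1 : ℝ) ≤ q := by exact_mod_cast (Finset.mem_Icc.1 hq).1
      nlinarith
    · rw [Finset.prod_const, Finset.card_univ, Fintype.card_fin, ENNReal.ofReal_pow (by positivity)]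
  refine ⟨(Set.univ.pi fun _ => Set.Icc 0 r) \ ⋃ q ∈ Finset.Icc 1 N, B q, ?_, ?_, ?_⟩
  · exact (MeasurableSet.univ_pi fun _ => measurableSet_Icc).diff
      (Finset.measurableSet_biUnion _ fun q _ => hBm q)
  · have h1 : volume (⋃ q ∈ Finset.Icc 1 N, B q) ≤ ENNReal.ofReal (r ^ d / 2) := by
      refine (measure_biUnion_finset_le _ _).trans ((Finset.sum_le_sum hBv).trans ?_)
      rw [Finset.sum_const, Nat.card_Icc, Nat.add_sub_cancel, ← ENNReal.ofReal_nsmul, nsmul_eq_mul]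
      refine ENNReal.ofReal_le_ofReal ?_
      have hN : (N : ℝ) ≤ (P : ℝ) ^ d / (2 * 4 ^ d) := Nat.floor_le (by positivity)
      calc (N : ℝ) * (4 * r / P) ^ d ≤ (P : ℝ) ^ d / (2 * 4 ^ d) * (4 * r / P) ^ d := by gcongr
        _ = r ^ d / 2 := by rw [div_pow, mul_pow]; field_simp
    have h2 : volume (Set.univ.pi fun _ : Fin d => Set.Icc (0 : ℝ) r) = ENNReal.ofReal (r ^ d) := by
      rw [volume_pi_pi, Finset.prod_const, Finset.card_univ, Fintype.card_fin, Real.volume_Icc,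
        sub_zero, ENNReal.ofReal_pow hr.le]
    refine le_trans ?_ le_measure_sdiff
    rw [h2]
    calc ENNReal.ofReal (r ^ d / 2) = ENNReal.ofReal (r ^ d) - ENNReal.ofReal (r ^ d / 2) := by
          rw [← ENNReal.ofReal_sub _ (by positivity)]
          congr 1
          ring
      _ ≤ _ := tsub_le_tsub_left h1 _
  · rintro x ⟨hx, hxB⟩
    have hx' : ∀ j, x j ∈ Set.Icc 0 r := fun j => hx j (Set.mem_univ j)
    refine ⟨hx', ?_⟩
    obtain ⟨q, hq0, hq, b, hb⟩ := exists_nat_forall_abs_mul_sub_lt (fun j => D * x j) hP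
    refine ⟨q, hq, ?_, b, hb⟩
    by_contra! h
    apply hxB
    simp only [Set.mem_iUnion, Finset.mem_Icc, exists_prop]
    refine ⟨q, ⟨hq0, Nat.le_floor h⟩, fun j _ => ⟨hx' j, b j, ?_⟩⟩
    rw [mul_assoc]
    exact hb j

end Dirichlet

/-! ### Euler's totient and the measure of neighbourhoods of admissible fractions. -/

section Totient

/-- The `i`-th smallest element is at least `i + 1`, so the product is at least the telescoping `∏ i
/ (i + 1)`. -/
theorem one_div_card_add_one_le_prod (S : Finset ℕ) (hS : ∀ p ∈ S, 2 ≤ p) :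
    1 / ((S.card : ℝ) + 1) ≤ ∏ p ∈ S, (1 - (p : ℝ)⁻¹) := by
  induction S using Finset.induction_on_max with
  | empty => simp
  | insert m s hm ih =>
    have hms : m ∉ s := fun h => lt_irrefl _ (hm m h)
    rw [Finset.prod_insert hms, Finset.card_insert_of_notMem hms]
    have hm2 : 2 ≤ m := hS m (Finset.mem_insert_self _ _)
    have ih := ih fun p hp => hS p (Finset.mem_insert_of_mem hp)
    have hcard : s.card + 2 ≤ m := by
      have : s ⊆ Finset.Ico 2 m := fun p hp =>
        Finset.mem_Ico.2 ⟨hS p (Finset.mem_insert_of_mem hp), hm p hp⟩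
      have := Finset.card_le_card this
      rw [Nat.card_Ico] at this
      omega
    have hc' : (s.card : ℝ) + 2 ≤ m := by exact_mod_cast hcard
    have h1 : ((s.card : ℝ) + 1) / (s.card + 2) ≤ 1 - (m : ℝ)⁻¹ := by
      have : (m : ℝ)⁻¹ ≤ ((s.card : ℝ) + 2)⁻¹ := inv_anti₀ (by positivity) hc'
      have e : ((s.card : ℝ) + 1) / (s.card + 2) = 1 - ((s.card : ℝ) + 2)⁻¹ := by
        field_simp; ring
      linarith
    calc 1 / (((s.card + 1 : ℕ) : ℝ) + 1)
        = ((s.card : ℝ) + 1) / (s.card + 2) * (1 / (s.card + 1)) := by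
          push_cast; field_simp; ring
      _ ≤ _ := mul_le_mul h1 ih (by positivity) (le_trans (by positivity) h1)

/-- A product of distinct primes is at least `2` to their number, so `q` has at most `log₂ q` prime
factors. The logarithmic loss is harmless for the exponent. -/
theorem div_log_add_one_le_totient {q : ℕ} (hq : 0 < q) :
    (q : ℝ) / (Nat.log 2 q + 1) ≤ q.totient := by
  have h := Nat.totient_eq_mul_prod_factors q
  have h' : (q.totient : ℝ) = q * ∏ p ∈ q.primeFactors, (1 - (p : ℝ)⁻¹) := by
    have := congrArg (fun x : ℚ => (x : ℝ)) h
    push_cast at this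
    exact this
  have hcard : q.primeFactors.card ≤ Nat.log 2 q := by
    refine Nat.le_log_of_pow_le (by norm_num) ?_
    calc 2 ^ q.primeFactors.card ≤ ∏ p ∈ q.primeFactors, p :=
          Finset.pow_card_le_prod _ _ _ fun p hp => (Nat.prime_of_mem_primeFactors hp).two_le
      _ ≤ q := Nat.le_of_dvd hq (Nat.prod_primeFactors_dvd q)
  rw [h', div_eq_mul_one_div]
  gcongr
  refine le_trans ?_ (one_div_card_add_one_le_prod _
    fun p hp => (Nat.prime_of_mem_primeFactors hp).two_le)
  gcongr

theorem card_filter_coprime_Ico_mul (q T : ℕ) :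
    ((Finset.Ico 1 (1 + q * T)).filter fun u => q.Coprime u).card = T * q.totient := by
  induction T with
  | zero => simp
  | succ T ih =>
    have e : Finset.Ico 1 (1 + q * (T + 1)) = Finset.Ico 1 (1 + q * T) ∪
        Finset.Ico (1 + q * T) (1 + q * T + q) := by
      rw [Finset.Ico_union_Ico_eq_Ico (by omega) (by omega)]
      congr 1
      ring
    rw [e, Finset.filter_union, Finset.card_union_of_disjoint, ih,
      Nat.filter_coprime_Ico_eq_totient]
    · ring
    · exact Finset.disjoint_filter_filter (Finset.Ico_disjoint_Ico_consecutive _ _ _)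

/-- The points of `[0, r]` close to an admissible fraction with denominator `q` have measure at
least a logarithmic factor of what one would have for all numerators. -/
theorem exists_measurableSet_close_fraction {q T : ℕ} (hq : 0 < q) {A r h : ℝ} (hA : 0 < A)
    (hh : 0 < h) (hhA : h ≤ 1 / (A * q)) (hT : 2 * T + 1 ≤ r * A) :
    ∃ G : Set ℝ, MeasurableSet G ∧
      ENNReal.ofReal (T * (q / (Nat.log 2 q + 1)) * h) ≤ volume G ∧
      ∀ x ∈ G, x ∈ Set.Icc 0 r ∧ ∃ a : ℕ, 0 < a ∧ Even ((a : ℤ) * q) ∧ IsCoprime (a : ℤ) (q : ℤ) ∧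
        (a : ℝ) / (A * q) ≤ r ∧ |x - a / (A * q)| ≤ h := by
  have hq' : (0 : ℝ) < q := by exact_mod_cast hq
  -- Numerators are taken as `a = κ u` with `u` coprime to `q`: `κ = 2` for odd `q` makes `a q` even
  -- without losing coprimality, and `κ = 1` suffices for even `q`.
  obtain ⟨κ, hκ1, hκ2, hκe, hκc⟩ : ∃ κ : ℕ, 1 ≤ κ ∧ κ ≤ 2 ∧ Even (κ * q) ∧ q.Coprime κ := by
    rcases Nat.even_or_odd q with h | h
    · exact ⟨1, le_rfl, by norm_num, by simpa using h, Nat.coprime_one_right _⟩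
    · exact ⟨2, by norm_num, le_rfl, by simp, h.coprime_two_right⟩
  let S := (Finset.Ico 1 (1 + q * T)).filter fun u => q.Coprime u
  let J : ℕ → Set ℝ := fun u => Set.Ico ((κ * u : ℕ) / (A * q)) ((κ * u : ℕ) / (A * q) + h)
  have hstep : ∀ u v : ℕ, u < v → ((κ * u : ℕ) : ℝ) / (A * q) + h ≤ (κ * v : ℕ) / (A * q) := by
    intro u v huv
    have h1 : κ * u + 1 ≤ κ * v := by nlinarith
    have h2 : ((κ * u : ℕ) : ℝ) + 1 ≤ (κ * v : ℕ) := by exact_mod_cast h1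
    calc ((κ * u : ℕ) : ℝ) / (A * q) + h ≤ ((κ * u : ℕ) : ℝ) / (A * q) + 1 / (A * q) := by gcongr
      _ = (((κ * u : ℕ) : ℝ) + 1) / (A * q) := by ring
      _ ≤ _ := by gcongr
  have hdisj : Set.PairwiseDisjoint (S : Set ℕ) J := by
    intro u _ v _ huv
    rcases lt_or_gt_of_ne huv with h | h
    · exact Set.disjoint_left.2 fun x hx hx' => absurd (hx.2.trans_le (hstep u v h))
        (not_lt.2 hx'.1)
    · exact Set.disjoint_left.2 fun x hx hx' => absurd (hx'.2.trans_le (hstep v u h))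
        (not_lt.2 hx.1)
  refine ⟨⋃ u ∈ S, J u, Finset.measurableSet_biUnion _ fun _ _ => measurableSet_Ico, ?_, ?_⟩
  · rw [measure_biUnion_finset hdisj fun _ _ => measurableSet_Ico]
    have e : ∀ u, volume (J u) = ENNReal.ofReal h := fun u => by
      simp only [J, Real.volume_Ico, add_sub_cancel_left]
    simp_rw [e]
    rw [Finset.sum_const, card_filter_coprime_Ico_mul, ← ENNReal.ofReal_nsmul, nsmul_eq_mul]
    refine ENNReal.ofReal_le_ofReal ?_
    push_cast
    gcongr
    exact div_log_add_one_le_totient hq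
  · intro x hx
    simp only [Set.mem_iUnion, exists_prop] at hx
    obtain ⟨u, hu, hx1, hx2⟩ := hx
    obtain ⟨hu1, hu2⟩ := Finset.mem_filter.1 hu
    have hu1 := Finset.mem_Ico.1 hu1
    have hκu : κ * u ≤ 2 * (q * T) := Nat.mul_le_mul hκ2 (by omega)
    have hκu' : ((κ * u : ℕ) : ℝ) ≤ 2 * (q * T) := by exact_mod_cast hκu
    have hq1 : (1 : ℝ) ≤ q := by exact_mod_cast hq
    have hend : ((κ * u : ℕ) : ℝ) / (A * q) + 1 / (A * q) ≤ r := by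
      rw [← add_div, div_le_iff₀ (by positivity)]
      nlinarith
    have hpos : (0 : ℝ) < 1 / (A * q) := by positivity
    refine ⟨⟨le_trans (by positivity) hx1, by linarith⟩, κ * u, Nat.mul_pos hκ1 hu1.1, ?_, ?_, by linarith, ?_⟩
    · have : Even (κ * u * q) := by
        rw [mul_right_comm]
        exact hκe.mul_right u
      exact_mod_cast this
    · rw [Nat.isCoprime_iff_coprime]
      exact (hκc.mul_right hu2).symm
    · rw [abs_le]
      constructor <;> linarith

end Totient

/-! ### Iterated integration over a cube inside the ball. -/

section Fubini

/-- Lower bound for an integral over the unit ball by iterated integration over a cube. -/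
theorem mul_le_setLIntegral_ball {d : ℕ} (hd : 1 ≤ d) {F : EuclideanSpace ℝ (Fin (d + 1)) → ℝ≥0∞}
    (hF : Measurable F) {A g : ℝ≥0∞} {G : Set (Fin d → ℝ)} (hG : MeasurableSet G)
    (hGr : ∀ x ∈ G, ∀ j, x j ∈ Set.Icc (0 : ℝ) (1 / (d + 1)))
    (hx : ∀ x ∈ G, ∃ S : Set ℝ, MeasurableSet S ∧ S ⊆ Set.Icc (0 : ℝ) (1 / (d + 1)) ∧
      g ≤ volume S ∧ ∀ y ∈ S, A ≤ F (WithLp.toLp 2 (Fin.cons y x))) :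
    A * g * volume G ≤ ∫⁻ x in Metric.ball (0 : EuclideanSpace ℝ (Fin (d + 1))) 1, F x := by
  have hball : ∀ z : Fin (d + 1) → ℝ, (∀ j, z j ∈ Set.Icc (0 : ℝ) (1 / (d + 1))) →
      (WithLp.toLp 2 z : EuclideanSpace ℝ (Fin (d + 1))) ∈ Metric.ball 0 1 := by
    intro z hz
    rw [mem_ball_zero_iff, ← sq_lt_one_iff₀ (norm_nonneg _), EuclideanSpace.norm_sq_eq]
    have h1 : ∀ j ∈ Finset.univ, ‖(WithLp.toLp 2 z : EuclideanSpace ℝ (Fin (d + 1))) j‖ ^ 2 ≤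
        ((1 : ℝ) / (d + 1)) ^ 2 := by
      intro j _
      have := hz j
      simp only [Real.norm_eq_abs, sq_abs]
      gcongr
      exacts [this.1, this.2]
    refine (Finset.sum_le_sum h1).trans_lt ?_
    have hd' : (1 : ℝ) ≤ d := by exact_mod_cast hd
    rw [Finset.sum_const, Finset.card_univ, Fintype.card_fin, nsmul_eq_mul, div_pow, one_pow]
    push_cast
    rw [mul_one_div, div_lt_one (by positivity)]
    nlinarith
  let Φ : ℝ × (Fin d → ℝ) ≃ᵐ EuclideanSpace ℝ (Fin (d + 1)) :=
    (MeasurableEquiv.piFinSuccAbove (fun _ => ℝ) 0).symm.trans (MeasurableEquiv.toLp 2 _)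
  have hΦ : MeasurePreserving Φ volume volume :=
    ((EuclideanSpace.volume_preserving_symm_measurableEquiv_toLp (Fin (d + 1))).symm).comp
      (volume_preserving_piFinSuccAbove (fun _ => ℝ) 0).symm
  have hΦe : ∀ y x, Φ (y, x) = WithLp.toLp 2 (Fin.cons y x) := by
    intro y x
    simp [Φ, MeasurableEquiv.piFinSuccAbove, Fin.insertNthEquiv]
  have hHm : Measurable ((Metric.ball (0 : EuclideanSpace ℝ (Fin (d + 1))) 1).indicator F) :=
    hF.indicator measurableSet_ball
  -- The first coordinate is integrated innermost: the good set `S` depends on `x` (through `q`),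
  -- and slicing needs no measurability of the union of the slices.
  rw [← lintegral_indicator measurableSet_ball, ← hΦ.lintegral_comp hHm, Measure.volume_eq_prod,
    lintegral_prod_symm (fun p => (Metric.ball (0 : EuclideanSpace ℝ (Fin (d + 1))) 1).indicator F
      (Φ p)) (hHm.comp Φ.measurable).aemeasurable, ← setLIntegral_const]
  refine le_trans ?_ (setLIntegral_le_lintegral G _)
  refine setLIntegral_mono' hG fun x hxG => ?_
  obtain ⟨S, hS, hSr, hSg, hSA⟩ := hx x hxG
  calc A * g ≤ A * volume S := by gcongr
    _ = ∫⁻ _ in S, A := (setLIntegral_const _ _).symm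
    _ ≤ ∫⁻ y in S, (Metric.ball (0 : EuclideanSpace ℝ (Fin (d + 1))) 1).indicator F (Φ (y, x)) := by
        refine setLIntegral_mono' hS fun y hy => ?_
        rw [hΦe, Set.indicator_of_mem]
        · exact hSA y hy
        · refine hball _ fun j => ?_
          refine Fin.cases ?_ (fun j => ?_) j
          · simpa using hSr hy
          · simpa using hGr x hxG j
    _ ≤ _ := setLIntegral_le_lintegral S _

end Fubini

/-! ### The counterexample and the size of its evolution. -/

section Construction

/-- The coordinate projections of the Fourier support of the counterexample: one interval of length
`m^(d+2) / 32` near `-m^(2d+4)`, and `d` families of `m^(d+1)` short intervals in arithmetic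
progression with difference `m^(d+3)`. -/
noncomputable def frequencySet (d m : ℕ) : Fin (d + 1) → Set ℝ :=
  Fin.cons (Set.Ico (-(m : ℝ) ^ (2 * d + 4)) (-(m : ℝ) ^ (2 * d + 4) + (m : ℝ) ^ (d + 2) / 32))
    fun _ => ⋃ l ∈ Finset.range (m ^ (d + 1)),
      Set.Ico ((m : ℝ) ^ (d + 3) * l) ((m : ℝ) ^ (d + 3) * l + 1 / 32)

theorem measurableSet_frequencySet (d m : ℕ) (j : Fin (d + 1)) :
    MeasurableSet (frequencySet d m j) := by
  refine Fin.cases ?_ (fun j => ?_) j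
  · exact measurableSet_Ico
  · exact Finset.measurableSet_biUnion _ fun _ _ => measurableSet_Ico

theorem volume_frequencySet {d m : ℕ} (hm : 1 ≤ m) :
    volume {η : EuclideanSpace ℝ (Fin (d + 1)) | ∀ j, η j ∈ frequencySet d m j} =
      ENNReal.ofReal ((m : ℝ) ^ (d + 2) / 32 * ((m : ℝ) ^ (d + 1) / 32) ^ d) := by
  have hm' : (1 : ℝ) ≤ m := by exact_mod_cast hm
  rw [volume_forall_coord_mem (measurableSet_frequencySet d m), Fin.prod_univ_succ]
  have h0 : volume (frequencySet d m 0) = ENNReal.ofReal ((m : ℝ) ^ (d + 2) / 32) := by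
    simp only [frequencySet, Fin.cons_zero, Real.volume_Ico, add_sub_cancel_left]
  have h1 : ∀ j : Fin d, volume (frequencySet d m j.succ) =
      ENNReal.ofReal ((m : ℝ) ^ (d + 1) / 32) := by
    intro j
    have hD : (1 : ℝ) ≤ (m : ℝ) ^ (d + 3) := one_le_pow₀ hm'
    simp only [frequencySet, Fin.cons_succ]
    rw [measure_biUnion_finset (pairwiseDisjoint_Ico_mul (by linarith) (by linarith) _)
      fun _ _ => measurableSet_Ico]
    simp only [Real.volume_Ico, add_sub_cancel_left]
    rw [Finset.sum_const, Finset.card_range, ← ENNReal.ofReal_nsmul, nsmul_eq_mul]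
    congr 1
    push_cast
    ring
  simp_rw [h0, h1]
  rw [Finset.prod_const, Finset.card_univ, Fintype.card_fin, ENNReal.ofReal_mul (by positivity),
    ENNReal.ofReal_pow (by positivity)]

theorem norm_le_of_mem_frequencySet {d m : ℕ} (hm : 1 ≤ m) {η : EuclideanSpace ℝ (Fin (d + 1))}
    (hη : ∀ j, η j ∈ frequencySet d m j) : ‖η‖ ≤ 2 * (d + 1) * (m : ℝ) ^ (2 * d + 4) := by
  have hm' : (1 : ℝ) ≤ m := by exact_mod_cast hm
  have hR : (1 : ℝ) ≤ (m : ℝ) ^ (2 * d + 4) := one_le_pow₀ hm'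
  have h : ∀ j, |η j| ≤ 2 * (m : ℝ) ^ (2 * d + 4) := by
    refine Fin.cases ?_ fun j => ?_
    · have h0 := hη 0
      simp only [frequencySet, Fin.cons_zero, Set.mem_Ico] at h0
      have : (m : ℝ) ^ (d + 2) ≤ (m : ℝ) ^ (2 * d + 4) := pow_le_pow_right₀ hm' (by omega)
      rw [abs_le]
      constructor <;> linarith
    · have h0 := hη j.succ
      simp only [frequencySet, Fin.cons_succ, Set.mem_iUnion, Finset.mem_range, Set.mem_Ico,
        exists_prop] at h0
      obtain ⟨l, hl, h1, h2⟩ := h0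
      have hl' : (l : ℝ) ≤ (m : ℝ) ^ (d + 1) := by exact_mod_cast hl.le
      have e : (m : ℝ) ^ (d + 3) * (m : ℝ) ^ (d + 1) = (m : ℝ) ^ (2 * d + 4) := by ring
      have h3 : (m : ℝ) ^ (d + 3) * l ≤ (m : ℝ) ^ (2 * d + 4) := by rw [← e]; gcongr
      have h4 : 0 ≤ (m : ℝ) ^ (d + 3) * l := by positivity
      rw [abs_le]
      constructor <;> linarith
  have hsq : ‖η‖ ^ 2 ≤ (2 * (d + 1) * (m : ℝ) ^ (2 * d + 4)) ^ 2 := by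
    rw [EuclideanSpace.norm_sq_eq]
    have h1 : ∀ j ∈ Finset.univ, ‖η j‖ ^ 2 ≤ (2 * (m : ℝ) ^ (2 * d + 4)) ^ 2 := by
      intro j _
      rw [Real.norm_eq_abs]
      gcongr
      exact h j
    refine (Finset.sum_le_sum h1).trans ?_
    rw [Finset.sum_const, Finset.card_univ, Fintype.card_fin, nsmul_eq_mul]
    push_cast
    have hd : (0 : ℝ) ≤ d := Nat.cast_nonneg d
    have : (2 * ((d : ℝ) + 1) * (m : ℝ) ^ (2 * d + 4)) ^ 2 =
        (d + 1) * ((d + 1) * (2 * (m : ℝ) ^ (2 * d + 4)) ^ 2) := by ring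
    rw [this]
    gcongr
    have : 0 ≤ (2 * (m : ℝ) ^ (2 * d + 4)) ^ 2 := by positivity
    nlinarith
  exact (sq_le_sq₀ (norm_nonneg _) (by positivity)).1 hsq

/-- The evolution is large at the points where the first coordinate is near an admissible fraction
and the others admit a simultaneous approximation with the same denominator. -/
theorem ofReal_le_iSup_enorm_evolution {d m q a : ℕ} (hm : 1 ≤ m) (hq : q ≤ (32 * m) ^ d)
    (hq2 : ((32 * m : ℕ) : ℝ) ^ d / (2 * 4 ^ d) < q)
    (hlog : 8 * (((32 * m : ℕ) : ℝ) ^ d * (3 + Real.log (((32 * m : ℕ) : ℝ) ^ d))) ≤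
      (m : ℝ) ^ (d + 1))
    (ha : 0 < a) (haq : Even ((a : ℤ) * q)) (hc : IsCoprime (a : ℤ) (q : ℤ))
    (ha1 : (a : ℝ) / ((m : ℝ) ^ 2 * q) ≤ 1) (b : Fin d → ℤ) {x : Fin d → ℝ} {y : ℝ}
    (hx : ∀ j, x j ∈ Set.Icc (0 : ℝ) 1)
    (hxb : ∀ j, |q * ((m : ℝ) ^ (d + 3) * x j) - b j| < 1 / ((32 * m : ℕ) : ℝ))
    (hy : |y - a / ((m : ℝ) ^ 2 * q)| ≤ 1 / (m : ℝ) ^ (d + 2)) :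
    ENNReal.ofReal ((m : ℝ) ^ (d + 2) / 64 *
      ((m : ℝ) ^ (d + 1) / (128 * √(((32 * m : ℕ) : ℝ) ^ d))) ^ d) ≤
      ⨆ t ∈ Set.Ioo (0 : ℝ) 1, ‖𝓕⁻ (fun η => schrodingerSymbol (d + 1) t η *
        {η : EuclideanSpace ℝ (Fin (d + 1)) | ∀ j, η j ∈ frequencySet d m j}.indicator
          (fun _ => (1 : ℂ)) η) (WithLp.toLp 2 (Fin.cons y x))‖ₑ := by
  have hm' : (1 : ℝ) ≤ m := by exact_mod_cast hm
  have hm0 : (0 : ℝ) < m := by linarith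
  set Q : ℝ := ((32 * m : ℕ) : ℝ) ^ d with hQ
  have hQ1 : 1 ≤ Q := one_le_pow₀ (by push_cast; linarith)
  have hq0 : (0 : ℝ) < q := lt_of_le_of_lt (by positivity) hq2
  have hq0' : 0 < q := by exact_mod_cast hq0
  have hq1 : (1 : ℝ) ≤ q := by exact_mod_cast hq0'
  have hqQ : (q : ℝ) ≤ Q := by rw [hQ]; exact_mod_cast hq
  have ha0 : (0 : ℝ) < a := by exact_mod_cast ha
  set D : ℝ := (m : ℝ) ^ (d + 3) with hD
  set R : ℝ := (m : ℝ) ^ (2 * d + 4) with hR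
  have hD1 : 1 ≤ D := one_le_pow₀ hm'
  have hR1 : 1 ≤ R := one_le_pow₀ hm'
  -- `D L = R` makes `2 τ D L = 2 R τ ≤ 1`, the bound needed on the cross terms of the lattice
  -- phases.
  have hDL : D * (m : ℝ) ^ (d + 1) = R := by rw [hD, hR]; ring
  set τ : ℝ := a / (2 * q * D ^ 2) with hτ
  have hτ0 : 0 < τ := by positivity
  have hτR : 2 * R * τ = a / ((m : ℝ) ^ 2 * q) := by
    rw [hτ, hR, hD]
    field_simp
    ring
  have hτR1 : 2 * R * τ ≤ 1 := hτR.trans_le ha1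
  have hτ1 : τ ≤ 1 := by nlinarith
  have hp := Real.pi_gt_three
  -- The factorized phase contains `2π t u²`, hence the time `t = τ / (2π)`.
  have ht : τ / (2 * Real.pi) ∈ Set.Ioo (0 : ℝ) 1 := by
    refine ⟨by positivity, ?_⟩
    rw [div_lt_one (by positivity)]
    linarith
  refine le_trans ?_ (le_iSup₂ (f := fun (t : ℝ) (_ : t ∈ Set.Ioo (0 : ℝ) 1) =>
    ‖𝓕⁻ (fun η => schrodingerSymbol (d + 1) t η *
        {η : EuclideanSpace ℝ (Fin (d + 1)) | ∀ j, η j ∈ frequencySet d m j}.indicator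
          (fun _ => (1 : ℂ)) η) (WithLp.toLp 2 (Fin.cons y x))‖ₑ) _ ht)
  have e2 : 2 * Real.pi * (τ / (2 * Real.pi)) = τ := by field_simp
  simp only [fourierInv_schrodingerSymbol_mul_indicator (measurableSet_frequencySet d m), e2]
  rw [← ofReal_norm, Fin.prod_univ_succ, norm_mul, norm_prod]
  refine ENNReal.ofReal_le_ofReal ?_
  have h0 : (m : ℝ) ^ (d + 2) / 64 ≤ ‖∫ u in frequencySet d m 0, unitExp (y * u + τ * u ^ 2)‖ := by
    have hw : (0 : ℝ) ≤ (m : ℝ) ^ (d + 2) / 32 := by positivity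
    have h := half_le_norm_integral_unitExp (x := y) (τ := τ) (R := R) hw ?_ hτ0.le ?_
    · refine le_trans (le_of_eq (by ring)) h
    · rw [hτR]
      calc _ ≤ 1 / (m : ℝ) ^ (d + 2) * ((m : ℝ) ^ (d + 2) / 32) := by gcongr
        _ = 1 / 32 := by field_simp
        _ ≤ 1 / 12 := by norm_num
    · have : τ * ((m : ℝ) ^ (d + 2) / 32) ^ 2 = 2 * R * τ / 2048 := by rw [hR]; ring
      rw [this]
      linarith
  have h1 : ∀ j : Fin d, (m : ℝ) ^ (d + 1) / (128 * √Q) ≤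
      ‖∫ u in frequencySet d m j.succ, unitExp (x j * u + τ * u ^ 2)‖ := by
    intro j
    have h := le_norm_integral_lattice (L := m ^ (d + 1)) (b := b j) (x := x j) (τ := τ) (D := D)
      hq0' haq hc (hx j).1 (hx j).2 hτ0.le hτ1 hD1 ?_ ?_ ?_
    · refine le_trans ?_ h
      have hsq : √(q : ℝ) * √q = q := Real.mul_self_sqrt hq0.le
      have hs0 : 0 < √(q : ℝ) := Real.sqrt_pos.2 hq0
      have hsQ : √(q : ℝ) ≤ √Q := Real.sqrt_le_sqrt hqQ
      have hlq : Real.log q ≤ Real.log Q := Real.log_le_log hq0 hqQ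
      have hlq0 : 0 ≤ Real.log q := Real.log_nonneg hq1
      -- `L` exceeds `q` by about a factor `m`, which beats the logarithm: the Gauss sum error is at
      -- most half of the main term.
      have hb : 8 * (q * (3 + Real.log q)) ≤ (m : ℝ) ^ (d + 1) :=
        le_trans (by gcongr) hlog
      have h2 : 2 * (√q * (3 + Real.log q)) ≤ (m : ℝ) ^ (d + 1) / (4 * √q) := by
        rw [le_div_iff₀ (by positivity)]
        calc _ = 8 * ((√q * √q) * (3 + Real.log q)) := by ring
          _ ≤ _ := by rw [hsq]; exact hb
      have h3 : (m : ℝ) ^ (d + 1) / (4 * √Q) ≤ (m : ℝ) ^ (d + 1) / (4 * √q) := by gcongr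
      have h4 : (m : ℝ) ^ (d + 1) / (2 * √q) = 2 * ((m : ℝ) ^ (d + 1) / (4 * √q)) := by
        field_simp; norm_num
      have h5 : (m : ℝ) ^ (d + 1) / (128 * √Q) = 1 / 32 * ((m : ℝ) ^ (d + 1) / (4 * √Q)) := by
        field_simp; norm_num
      rw [h5]
      push_cast
      rw [h4]
      gcongr
      linarith
    · rw [hτ]
      push_cast
      field_simp
    · push_cast
      rw [hDL]
      linarith
    · have hP : (0 : ℝ) < ((32 * m : ℕ) : ℝ) := by push_cast; positivity
      have e : x j * D - b j / q = (q * (D * x j) - b j) / q := by field_simp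
      push_cast
      rw [e, abs_div, abs_of_pos hq0]
      -- Here the lower bound on `q` is essential: `L / (P q)` stays bounded only for `q` comparable
      -- to `P^d`. The factor `32` in `P` brings the bound down to `1/16`.
      calc (m : ℝ) ^ (d + 1) * (|q * (D * x j) - b j| / q)
          ≤ (m : ℝ) ^ (d + 1) * (1 / ((32 * m : ℕ) : ℝ) / (Q / (2 * 4 ^ d))) := by
            gcongr
            exact (hxb j).le
        _ = 1 / 16 * (1 / 8) ^ d := by
            have h32 : (32 : ℝ) ^ d = 8 ^ d * 4 ^ d := by rw [← mul_pow]; norm_num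
            rw [hQ]
            push_cast
            rw [mul_pow, h32, div_pow, one_pow]
            field_simp
            ring
        _ ≤ 1 / 16 := by
            have : ((1 : ℝ) / 8) ^ d ≤ 1 := pow_le_one₀ (by norm_num) (by norm_num)
            linarith
  have h2 : ((m : ℝ) ^ (d + 1) / (128 * √Q)) ^ d ≤
      ∏ j : Fin d, ‖∫ u in frequencySet d m j.succ, unitExp (x j * u + τ * u ^ 2)‖ := by
    calc _ = ∏ _j : Fin d, (m : ℝ) ^ (d + 1) / (128 * √Q) := by simp [div_pow]
      _ ≤ _ := Finset.prod_le_prod (fun _ _ => by positivity) fun j _ => h1 j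
  simp only [Fin.cons_zero, Fin.cons_succ]
  exact mul_le_mul h0 h2 (by positivity) (norm_nonneg _)

end Construction

/-! ### Comparison of the two norms as `m` grows. -/

section Conclusion

theorem memLp_indicator_frequencySet {d m : ℕ} (hm : 1 ≤ m) (p : ℝ≥0∞) :
    MemLp ({η : EuclideanSpace ℝ (Fin (d + 1)) | ∀ j, η j ∈ frequencySet d m j}.indicator
      fun _ => (1 : ℂ)) p volume :=
  memLp_indicator_const p (measurableSet_forall_coord_mem (measurableSet_frequencySet d m)) 1
    (Or.inr (by rw [volume_frequencySet hm]; exact ENNReal.ofReal_ne_top))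

theorem le_schrodingerMaximalNorm {d m : ℕ} (hd : 1 ≤ d) (hm : 1 ≤ m)
    (hm6 : 6 * ((d : ℝ) + 1) ≤ (m : ℝ) ^ 2)
    (hlog : 8 * (((32 * m : ℕ) : ℝ) ^ d * (3 + Real.log (((32 * m : ℕ) : ℝ) ^ d))) ≤
      (m : ℝ) ^ (d + 1)) :
    ENNReal.ofReal ((m : ℝ) ^ (d + 2) / 64 *
      ((m : ℝ) ^ (d + 1) / (128 * √(((32 * m : ℕ) : ℝ) ^ d))) ^ d *
      (1 / (8 * 4 ^ d * (d + 1) * (Nat.log 2 ((32 * m) ^ d) + 1))) * ((1 / (d + 1)) ^ d / 2)) ≤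
    schrodingerMaximalNorm (𝓕⁻ (memLp_indicator_frequencySet (d := d) hm 2).toLp) := by
  have hm' : (1 : ℝ) ≤ m := by exact_mod_cast hm
  have hm0 : (0 : ℝ) < m := by linarith
  have hint := memLp_one_iff_integrable.1 (memLp_indicator_frequencySet (d := d) hm 1)
  rw [schrodingerMaximalNorm_fourierInv hint]
  have hr : (0 : ℝ) < 1 / (d + 1) := by positivity
  have hr1 : (1 : ℝ) / (d + 1) ≤ 1 := by
    rw [div_le_one (by positivity)]
    linarith [(Nat.cast_nonneg d : (0 : ℝ) ≤ d)]
  have hP : 0 < 32 * m := by omega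
  have hDr : 2 ≤ (m : ℝ) ^ (d + 3) * (1 / (d + 1)) := by
    have : (m : ℝ) ^ 2 ≤ (m : ℝ) ^ (d + 3) := pow_le_pow_right₀ hm' (by omega)
    rw [mul_one_div, le_div_iff₀ (by positivity)]
    have hd0 : (0 : ℝ) ≤ d := Nat.cast_nonneg d
    linarith
  obtain ⟨G, hGm, hGv, hG⟩ := exists_measurableSet_approximable (d := d) hr hDr hP
  rw [ENNReal.ofReal_mul (by positivity), ENNReal.ofReal_mul (by positivity)]
  refine le_trans (mul_le_mul_right hGv _) ?_
  refine mul_le_setLIntegral_ball hd (measurable_iSup_enorm_fourierInv hint) hGm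
    (fun x hx => (hG x hx).1) fun x hx => ?_
  obtain ⟨hx1, q, hqP, hq2, b, hb⟩ := hG x hx
  have hq0 : (0 : ℝ) < q := lt_of_le_of_lt (by positivity) hq2
  have hq0' : 0 < q := by exact_mod_cast hq0
  have hqP' : (q : ℝ) ≤ 32 ^ d * (m : ℝ) ^ d := by
    rw [← mul_pow]
    exact_mod_cast hqP
  have hm2 : (0 : ℝ) < (m : ℝ) ^ 2 := by positivity
  -- The half-width is the allowed `m^(-(d+2))` shrunk by `32^d`, so that it is at most the spacing
  -- `1 / (m² q)` for every `q ≤ (32 m)^d`.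
  have hh : (0 : ℝ) < 1 / (32 ^ d * (m : ℝ) ^ (d + 2)) := by positivity
  have hhA : 1 / (32 ^ d * (m : ℝ) ^ (d + 2)) ≤ 1 / ((m : ℝ) ^ 2 * q) := by
    apply one_div_le_one_div_of_le (by positivity)
    calc (m : ℝ) ^ 2 * q ≤ (m : ℝ) ^ 2 * (32 ^ d * (m : ℝ) ^ d) := by gcongr
      _ = _ := by ring
  have hX : 6 ≤ 1 / ((d : ℝ) + 1) * (m : ℝ) ^ 2 := by
    rw [one_div_mul_eq_div, le_div_iff₀ (by positivity)]
    exact hm6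
  set X := 1 / ((d : ℝ) + 1) * (m : ℝ) ^ 2 with hXdef
  -- With `T = ⌈X / 4⌉`, `2 T + 1 < X / 2 + 3`, and this is at most `X` exactly when `X ≥ 6`.
  have hT : 2 * ((⌈X / 4⌉₊ : ℕ) : ℝ) + 1 ≤ X := by
    have := Nat.ceil_lt_add_one (by linarith : 0 ≤ X / 4)
    linarith
  obtain ⟨S, hSm, hSv, hS⟩ := exists_measurableSet_close_fraction hq0' hm2 hh hhA hT
  refine ⟨S, hSm, fun y hy => (hS y hy).1, le_trans (ENNReal.ofReal_le_ofReal ?_) hSv,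
    fun y hy => ?_⟩
  · have hl : (Nat.log 2 q : ℝ) ≤ Nat.log 2 ((32 * m) ^ d) := by
      exact_mod_cast Nat.log_mono_right hqP
    calc 1 / (8 * 4 ^ d * ((d : ℝ) + 1) * (Nat.log 2 ((32 * m) ^ d) + 1))
        = X / 4 * (((32 * m : ℕ) : ℝ) ^ d / (2 * 4 ^ d) / (Nat.log 2 ((32 * m) ^ d) + 1)) *
          (1 / (32 ^ d * (m : ℝ) ^ (d + 2))) := by
          rw [hXdef]
          push_cast
          rw [mul_pow]
          field_simp
          ring
      _ ≤ _ := by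
          gcongr
          exact Nat.le_ceil _
  · obtain ⟨hy1, a, ha, haq, hc, har, hya⟩ := hS y hy
    refine ofReal_le_iSup_enorm_evolution hm hqP hq2 hlog ha haq hc (har.trans hr1) b
      (fun j => ⟨(hx1 j).1, (hx1 j).2.trans hr1⟩) hb (hya.trans ?_)
    apply one_div_le_one_div_of_le (by positivity)
    have : (1 : ℝ) ≤ 32 ^ d := one_le_pow₀ (by norm_num)
    exact le_mul_of_one_le_left (by positivity) this

theorem eventually_add_mul_log_le_rpow (α β : ℝ) {ε : ℝ} (hε : 0 < ε) :
    ∀ᶠ m : ℕ in Filter.atTop, α + β * Real.log m ≤ (m : ℝ) ^ ε := by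
  have h : (fun x : ℝ => α + β * Real.log x) =o[Filter.atTop] fun x : ℝ => x ^ ε := by
    refine Asymptotics.IsLittleO.add ?_ ((isLittleO_log_rpow_atTop hε).const_mul_left β)
    rw [Asymptotics.isLittleO_const_left]
    right
    exact tendsto_norm_atTop_atTop.comp (tendsto_rpow_atTop hε)
  have h2 := tendsto_natCast_atTop_atTop.eventually (h.bound one_pos)
  filter_upwards [h2] with m hm
  rw [one_mul, Real.norm_eq_abs, Real.norm_eq_abs, abs_of_nonneg (by positivity : 0 ≤ (m : ℝ) ^ ε)]
    at hm
  exact (le_abs_self _).trans hm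

theorem log_pow_mul_le {d m : ℕ} (hm : 1 ≤ m) :
    Real.log (((32 * m : ℕ) : ℝ) ^ d) = d * (Real.log 32 + Real.log m) := by
  have : (m : ℝ) ≠ 0 := by positivity
  rw [Real.log_pow]
  push_cast
  rw [Real.log_mul (by norm_num) this]

/-- The polynomial growth that the maximal estimate would have to absorb. -/
theorem exists_pow_le_of_maximal_estimate {d : ℕ} (hd : 1 ≤ d) {s : ℝ} (hs : 0 < s) {C : ℝ≥0}
    (h : ∀ f : Lp ℂ 2 (volume : Measure (EuclideanSpace ℝ (Fin (d + 1)))),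
      TemperedDistribution.MemSobolev s 2
        (f : TemperedDistribution (EuclideanSpace ℝ (Fin (d + 1))) ℂ) →
      schrodingerMaximalNorm f ≤ C * sobolevNorm s f) :
    ∃ K : ℝ, 0 ≤ K ∧ ∀ᶠ m : ℕ in Filter.atTop,
      (m : ℝ) ^ (2 * d + 2) ≤
        K * (Nat.log 2 ((32 * m) ^ d) + 1) ^ 2 * ((m : ℝ) ^ (2 * d + 4)) ^ (2 * s) := by
  let κ : ℝ := 1 + (4 * Real.pi * (d + 1)) ^ 2
  let k : ℝ := 32 * 32 ^ d / (64 ^ 2 * 128 ^ (2 * d) * 32 ^ (d * d))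
  let c : ℝ := 1 / (8 * 4 ^ d * (d + 1)) * ((1 / (d + 1)) ^ d / 2)
  have hk : 0 < k := by positivity
  have hc : 0 < c := by positivity
  refine ⟨C ^ 2 * κ ^ s / (k * c ^ 2), by positivity, ?_⟩
  have ev1 := eventually_add_mul_log_le_rpow (8 * 32 ^ d * (3 + d * Real.log 32)) (8 * 32 ^ d * d)
    one_pos
  filter_upwards [ev1, Filter.eventually_ge_atTop (6 * (d + 1))] with m hm1 hm6
  have hm : 1 ≤ m := by omega
  have hm' : (1 : ℝ) ≤ m := by exact_mod_cast hm
  have hm0 : (0 : ℝ) < m := by linarith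
  have hm6' : 6 * ((d : ℝ) + 1) ≤ (m : ℝ) ^ 2 := by
    have : 6 * ((d : ℝ) + 1) ≤ m := by exact_mod_cast hm6
    nlinarith
  have hlog : 8 * (((32 * m : ℕ) : ℝ) ^ d * (3 + Real.log (((32 * m : ℕ) : ℝ) ^ d))) ≤
      (m : ℝ) ^ (d + 1) := by
    rw [Real.rpow_one] at hm1
    rw [log_pow_mul_le hm]
    push_cast
    calc 8 * ((32 * (m : ℝ)) ^ d * (3 + d * (Real.log 32 + Real.log m))) =
        (m : ℝ) ^ d * (8 * 32 ^ d * (3 + d * Real.log 32) + 8 * 32 ^ d * d * Real.log m) := by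
          rw [mul_pow]; ring
      _ ≤ (m : ℝ) ^ d * m := by gcongr
      _ = _ := by ring
  have hρ := fun (η : EuclideanSpace ℝ (Fin (d + 1)))
    (hη : η ∈ {η : EuclideanSpace ℝ (Fin (d + 1)) | ∀ j, η j ∈ frequencySet d m j}) =>
    norm_le_of_mem_frequencySet hm hη
  have hS := measurableSet_forall_coord_mem (measurableSet_frequencySet d m)
  have h2 := memLp_indicator_frequencySet (d := d) hm 2
  have h3 := ((le_schrodingerMaximalNorm hd hm hm6' hlog).trans
    (h _ (memSobolev_fourierInv_toLp s h2 fun η hη => hρ η (Set.mem_of_indicator_ne_zero hη)))).trans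
    (mul_le_mul_right (sobolevNorm_fourierInv_indicator_le hs.le hS h2 hρ) _)
  rw [volume_frequencySet hm] at h3
  set A := (m : ℝ) ^ (d + 2) / 64 *
      ((m : ℝ) ^ (d + 1) / (128 * √(((32 * m : ℕ) : ℝ) ^ d))) ^ d with hA
  set V := (m : ℝ) ^ (d + 2) / 32 * ((m : ℝ) ^ (d + 1) / 32) ^ d with hV
  set R := (m : ℝ) ^ (2 * d + 4) with hR
  set ℓ : ℝ := (Nat.log 2 ((32 * m) ^ d) : ℝ) + 1 with hℓ
  have hℓ0 : 0 < ℓ := by positivity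
  have hV0 : 0 < V := by positivity
  have hR1 : 1 ≤ R := one_le_pow₀ hm'
  set W := (1 + (2 * Real.pi * (2 * (d + 1) * R)) ^ 2) ^ s with hW
  have hW0 : 0 ≤ W := by positivity
  have hWle : W ≤ κ ^ s * R ^ (2 * s) := by
    rw [hW, Real.rpow_mul (by positivity), ← Real.mul_rpow (by positivity) (by positivity)]
    refine Real.rpow_le_rpow (by positivity) ?_ hs.le
    have e : R ^ (2 : ℝ) = R ^ 2 := by norm_cast
    rw [e]
    have : 1 ≤ R ^ 2 := one_le_pow₀ hR1
    calc 1 + (2 * Real.pi * (2 * (d + 1) * R)) ^ 2 =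
        1 + (4 * Real.pi * (d + 1)) ^ 2 * R ^ 2 := by ring
      _ ≤ R ^ 2 + (4 * Real.pi * (d + 1)) ^ 2 * R ^ 2 := by gcongr
      _ = κ * R ^ 2 := by ring
  -- The gain: the powers of `m` in `A² / V` add up to `(d + 2) + d (d + 1) - d² = 2d + 2`.
  have hAsq : A ^ 2 = k * (m : ℝ) ^ (2 * d + 2) * V := by
    have hs2 : √(((32 * m : ℕ) : ℝ) ^ d) ^ 2 = 32 ^ d * (m : ℝ) ^ d := by
      rw [Real.sq_sqrt (by positivity)]
      push_cast
      rw [mul_pow]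
    have e1 : A ^ 2 = ((m : ℝ) ^ (d + 2)) ^ 2 / 64 ^ 2 * ((m : ℝ) ^ (d + 1)) ^ (2 * d) /
        (128 ^ (2 * d) * (√(((32 * m : ℕ) : ℝ) ^ d) ^ 2) ^ d) := by
      rw [hA, div_pow, mul_pow (128 : ℝ)]
      field_simp
      ring
    rw [e1, hs2, hV]
    simp only [k]
    rw [mul_pow, ← pow_mul, ← pow_mul, div_pow]
    field_simp
    ring
  have h4 : A * (1 / (8 * 4 ^ d * (d + 1) * ℓ)) * ((1 / (d + 1)) ^ d / 2) ≤ C * √(W * V) := by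
    rw [← ENNReal.ofReal_mul hW0, ENNReal.ofReal_rpow_of_nonneg (by positivity) (by norm_num),
      ← Real.sqrt_eq_rpow, ← ENNReal.ofReal_coe_nnreal, ← ENNReal.ofReal_mul (by positivity)] at h3
    exact (ENNReal.ofReal_le_ofReal_iff (by positivity)).1 h3
  have e4 : A * (1 / (8 * 4 ^ d * (d + 1) * ℓ)) * ((1 / (d + 1)) ^ d / 2) = A * c / ℓ := by
    simp only [c]
    field_simp
  rw [e4] at h4
  have hA0 : 0 ≤ A := by positivity
  have h5 := pow_le_pow_left₀ (by positivity) h4 2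
  rw [mul_pow, Real.sq_sqrt (by positivity), div_pow, mul_pow, hAsq, div_le_iff₀ (by positivity)] at h5
  have h6 : k * (m : ℝ) ^ (2 * d + 2) * c ^ 2 ≤ C ^ 2 * (κ ^ s * R ^ (2 * s)) * ℓ ^ 2 := by
    refine le_of_mul_le_mul_right ?_ hV0
    calc k * (m : ℝ) ^ (2 * d + 2) * c ^ 2 * V = k * (m : ℝ) ^ (2 * d + 2) * V * c ^ 2 := by ring
      _ ≤ C ^ 2 * (W * V) * ℓ ^ 2 := h5
      _ ≤ C ^ 2 * ((κ ^ s * R ^ (2 * s)) * V) * ℓ ^ 2 := by gcongr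
      _ = _ := by ring
  have e6 : C ^ 2 * κ ^ s / (k * c ^ 2) * ℓ ^ 2 * R ^ (2 * s) =
      C ^ 2 * (κ ^ s * R ^ (2 * s)) * ℓ ^ 2 / (k * c ^ 2) := by ring
  rw [e6, le_div_iff₀ (by positivity)]
  linarith

end Conclusion

theorem theorem2p1 (n : ℕ) (hn : 2 ≤ n) (s : ℝ) (hs : 0 < s)
    (h : ∃ C : ℝ≥0, ∀ f : Lp ℂ 2 (volume : Measure (EuclideanSpace ℝ (Fin n))),
      TemperedDistribution.MemSobolev s 2
        (f : TemperedDistribution (EuclideanSpace ℝ (Fin n)) ℂ) →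
      schrodingerMaximalNorm f ≤ C * sobolevNorm s f) :
    (n : ℝ) / (2 * ((n : ℝ) + 1)) ≤ s := by
  obtain ⟨d, rfl⟩ : ∃ d, n = d + 1 := ⟨n - 1, by omega⟩
  obtain ⟨C, hC⟩ := h
  obtain ⟨K, hK, hev⟩ := exists_pow_le_of_maximal_estimate (by omega : 1 ≤ d) hs hC
  by_contra! hlt
  push_cast at hlt
  rw [lt_div_iff₀ (by positivity)] at hlt
  have hε : 0 < (d : ℝ) + 1 - (2 * d + 4) * s := by linarith
  -- `ε` is the power of `m` left over if `s` is below the threshold; it must dominate the logarithm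
  -- `ℓ`.
  set ε := (d : ℝ) + 1 - (2 * d + 4) * s with hεdef
  have ev := eventually_add_mul_log_le_rpow ((K + 1) * (d * Real.log 32 / Real.log 2 + 1))
    ((K + 1) * (d / Real.log 2)) hε
  obtain ⟨m, hm1, hm2, hm⟩ := (hev.and (ev.and (Filter.eventually_ge_atTop 1))).exists
  have hm0 : (0 : ℝ) < m := by exact_mod_cast hm
  set ℓ : ℝ := (Nat.log 2 ((32 * m) ^ d) : ℝ) + 1 with hℓ
  have hℓ0 : 0 < ℓ := by positivity
  have hℓle : (K + 1) * ℓ ≤ (m : ℝ) ^ ε := by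
    refine le_trans ?_ hm2
    have h1 : (Nat.log 2 ((32 * m) ^ d) : ℝ) ≤ d * (Real.log 32 + Real.log m) / Real.log 2 := by
      refine (Real.natLog_le_logb _ _).trans_eq ?_
      rw [Real.logb, ← log_pow_mul_le hm]
      push_cast
      rfl
    calc (K + 1) * ℓ ≤ (K + 1) * (d * (Real.log 32 + Real.log m) / Real.log 2 + 1) := by gcongr; linarith
      _ = _ := by ring
  have e1 : (m : ℝ) ^ (2 * d + 2) = ((m : ℝ) ^ ε) ^ 2 * ((m : ℝ) ^ (2 * d + 4)) ^ (2 * s) := by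
    rw [← Real.rpow_natCast, ← Real.rpow_natCast, ← Real.rpow_natCast, ← Real.rpow_mul hm0.le,
      ← Real.rpow_mul hm0.le, ← Real.rpow_add hm0]
    congr 1
    push_cast
    rw [hεdef]
    ring
  rw [e1] at hm1
  have h2 := le_of_mul_le_mul_right hm1 (by positivity)
  have h3 := (pow_le_pow_left₀ (by positivity) hℓle 2).trans h2
  have h4 : 0 < ℓ ^ 2 := by positivity
  -- `(K + 1)² ℓ² ≤ K ℓ²` is impossible for `K ≥ 0` and `ℓ > 0`.
  nlinarith [mul_nonneg hK h4.le, mul_nonneg (mul_nonneg hK hK) h4.le]
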